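/- \textbf{Conventions.} Work in continuous logic. A continuous language $\mathcal L$ has sorts, each with a directed family of domains of quantification, and function and predicate symbols, each with prescribed bounds and moduli of uniform continuity on every choice of domains. In an $\mathcal L$-structure each sort is a metric space that is the union of its domains; each domain is nonempty, bounded (by a constant given by $\mathcal L$) and complete; domains increase with their index. An embedding of $\mathcal L$-structures is a map that preserves the metric and the interpretations of all symbols and maps every domain into the corresponding domain. Quantifier-free formulas are built from atomic formulas (including the metric) using continuous connectives $\mathbb R^n\to\mathbb R$; general formulas allow also $\sup_{x\in D}$ and $\inf_{x\in D}$ over domains $D$. A theory $T$ is a set of closed conditions $\sigma=0$; its models are the structures satisfying all of them. (It need not be assumed that $T$ is closed under logical implication.) Let $\mathcal K$ be a class of $\mathcal L$-structures. A structure $A\in\mathcal K$ is \emph{existentially closed (e.c.) for $\mathcal K$} if for every embedding $i:A\to N$ with $N\in\mathcal K$, every quantifier-free formula $\varphi(\vec x,\vec y)$, all domains $\vec D$ for $\vec x$ and every tuple $\vec a$ from $A$, $$\inf_{\vec c\in \vec D(A)}\varphi(\vec c,\vec a)^A=\inf_{\vec b\in \vec D(N)}\varphi(\vec b,i(\vec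 a))^N .$$ An e.c.\ model of $T$ is an e.c.\ member of the class of models of $T$. A structure $A\in\mathcal K$ is a \emph{strong amalgamation base for $\mathcal K$} if for all $B,C\in\mathcal K$ and embeddings $i:A\to B$, $j:A\to C$ there are $D\in\mathcal K$ and embeddings $f:B\to D$, $g:C\to D$ with $f\circ i=g\circ j$ and $f(B)\cap g(C)=f(i(A))$ (in every sort). A tracial von Neumann algebra is a von Neumann algebra with a faithful normal tracial state $\operatorname{tr}$; it is viewed as a one-sorted structure with metric $\|x-y\|_2$, where $\|x\|_2=\operatorname{tr}(x^*x)^{1/2}$, with the operator-norm balls of radius $n\in\mathbb N$ as domains, and with symbols for $0$, $1$, $+$, $\cdot$, $*$, scalar multiplication by each $\lambda\in\mathbb C$, and $\operatorname{Re}\operatorname{tr}$, $\operatorname{Im}\operatorname{tr}$. Let $\mathcal R$ be the hyperfinite II$_1$ factor. A tracial von Neumann algebra is \emph{$\mathcal R^\omega$-embeddable} if it embeds into the tracial ultrapower $\mathcal R^{\mathcal U}$ for some nonprincipal ultrafilter $\mathcal U$ on some index set. \textbf{Theorem.} (1) Let $T$ be a theory in a continuous language and let $A$ be an e.c.\ model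 of $T$. Then $A$ is a strong amalgamation base for the class of models of $T$. (2) Every e.c.\ member of the class of $\mathcal R^\omega$-embeddable tracial von Neumann algebras is a strong amalgamation base for that class. -/

import Mathlib

open Filter Topology

universe u w w'

/-! ## Continuous logic -/

/-- A many-sorted continuous language with domains of quantification. Every sort carries a
directed family of (names of) bounded domains; every function symbol comes, for each choice of
domains for its arguments, with a domain containing its values and a modulus of uniform continuity,
and every predicate symbol with a bound and a modulus of uniform continuity. Languages for bounded
metric structures are those in which every sort has a single domain. -/
structure MetricLanguage : Type (u + 1) where
  Srt : Type u
  Dom : Srt → Type u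
  domPreorder : ∀ s, Preorder (Dom s)
  dom_directed : ∀ (s : Srt) (D E : Dom s), ∃ F, (domPreorder s).le D F ∧ (domPreorder s).le E F
  diam : ∀ {s : Srt}, Dom s → ℝ
  Func : Type u
  funcArity : Func → ℕ
  funcIn : ∀ f : Func, Fin (funcArity f) → Srt
  funcOut : Func → Srt
  funcDom : ∀ f : Func, (∀ j, Dom (funcIn f j)) → Dom (funcOut f)
  funcMod : ∀ f : Func, (∀ j, Dom (funcIn f j)) → ℝ → ℝ
  funcMod_pos : ∀ (f : Func) (D : ∀ j, Dom (funcIn f j)) (ε : ℝ), 0 < ε → 0 < funcMod f D ε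
  Rel : Type u
  relArity : Rel → ℕ
  relIn : ∀ R : Rel, Fin (relArity R) → Srt
  relBound : ∀ R : Rel, (∀ j, Dom (relIn R j)) → ℝ
  relMod : ∀ R : Rel, (∀ j, Dom (relIn R j)) → ℝ → ℝ
  relMod_pos : ∀ (R : Rel) (D : ∀ j, Dom (relIn R j)) (ε : ℝ), 0 < ε → 0 < relMod R D ε

instance MetricLanguage.instPreorderDom (L : MetricLanguage.{u}) (s : L.Srt) :
    Preorder (L.Dom s) := L.domPreorder s

/-- A metric structure for `L`: every sort is a metric space which is the union of its domains,
the domains are nonempty, bounded and complete, and the symbols of `L` are interpreted by functions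
and real-valued predicates obeying the bounds and moduli prescribed by `L`. -/
structure MetricStructure (L : MetricLanguage.{u}) : Type (max u (w + 1)) where
  carrier : L.Srt → Type w
  metric : ∀ s, MetricSpace (carrier s)
  dom : ∀ {s : L.Srt}, L.Dom s → Set (carrier s)
  dom_nonempty : ∀ {s : L.Srt} (D : L.Dom s), (dom D).Nonempty
  dom_mono : ∀ {s : L.Srt} {D E : L.Dom s}, D ≤ E → dom D ⊆ dom E
  dom_cover : ∀ {s : L.Srt} (x : carrier s), ∃ D : L.Dom s, x ∈ dom D
  dom_complete : ∀ {s : L.Srt} (D : L.Dom s), IsComplete (dom D)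
  dom_diam : ∀ {s : L.Srt} (D : L.Dom s), ∀ x ∈ dom D, ∀ y ∈ dom D, dist x y ≤ L.diam D
  func : ∀ f : L.Func, (∀ j, carrier (L.funcIn f j)) → carrier (L.funcOut f)
  func_mem : ∀ (f : L.Func) (D : ∀ j, L.Dom (L.funcIn f j)) (x : ∀ j, carrier (L.funcIn f j)),
    (∀ j, x j ∈ dom (D j)) → func f x ∈ dom (L.funcDom f D)
  func_unif : ∀ (f : L.Func) (D : ∀ j, L.Dom (L.funcIn f j)) (ε : ℝ), 0 < ε →
    ∀ x y : ∀ j, carrier (L.funcIn f j), (∀ j, x j ∈ dom (D j)) → (∀ j, y j ∈ dom (D j)) →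
      (∀ j, dist (x j) (y j) < L.funcMod f D ε) → dist (func f x) (func f y) ≤ ε
  rel : ∀ R : L.Rel, (∀ j, carrier (L.relIn R j)) → ℝ
  rel_bound : ∀ (R : L.Rel) (D : ∀ j, L.Dom (L.relIn R j)) (x : ∀ j, carrier (L.relIn R j)),
    (∀ j, x j ∈ dom (D j)) → |rel R x| ≤ L.relBound R D
  rel_unif : ∀ (R : L.Rel) (D : ∀ j, L.Dom (L.relIn R j)) (ε : ℝ), 0 < ε →
    ∀ x y : ∀ j, carrier (L.relIn R j), (∀ j, x j ∈ dom (D j)) → (∀ j, y j ∈ dom (D j)) →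
      (∀ j, dist (x j) (y j) < L.relMod R D ε) → |rel R x - rel R y| ≤ ε

instance MetricStructure.instMetricSpaceCarrier {L : MetricLanguage.{u}}
    (M : MetricStructure.{u, w} L) (s : L.Srt) : MetricSpace (M.carrier s) := M.metric s

/-- Terms of sort `s` in free variables whose sorts are listed by `Γ`. -/
inductive MetricLanguage.Term (L : MetricLanguage.{u}) (Γ : List L.Srt) : L.Srt → Type u
  | var (i : Fin Γ.length) : MetricLanguage.Term L Γ (Γ.get i)
  | app (f : L.Func) (t : ∀ j, MetricLanguage.Term L Γ (L.funcIn f j)) :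
      MetricLanguage.Term L Γ (L.funcOut f)

/-- Formulas in free variables whose sorts are listed by `Γ`. Connectives are arbitrary continuous
functions `ℝⁿ → ℝ`; the quantifiers `sup` and `inf` range over a domain and bind the variable at the
head of the list. -/
inductive MetricLanguage.Formula (L : MetricLanguage.{u}) : List L.Srt → Type u
  | dist {Γ : List L.Srt} {s : L.Srt} (t t' : L.Term Γ s) : MetricLanguage.Formula L Γ
  | rel {Γ : List L.Srt} (R : L.Rel) (t : ∀ j, L.Term Γ (L.relIn R j)) :
      MetricLanguage.Formula L Γ
  | conn {Γ : List L.Srt} (n : ℕ) (c : C(Fin n → ℝ, ℝ))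
      (φ : Fin n → MetricLanguage.Formula L Γ) : MetricLanguage.Formula L Γ
  | sup {Γ : List L.Srt} {s : L.Srt} (D : L.Dom s) (φ : MetricLanguage.Formula L (s :: Γ)) :
      MetricLanguage.Formula L Γ
  | inf {Γ : List L.Srt} {s : L.Srt} (D : L.Dom s) (φ : MetricLanguage.Formula L (s :: Γ)) :
      MetricLanguage.Formula L Γ

abbrev MetricLanguage.Sentence (L : MetricLanguage.{u}) : Type u := L.Formula []

/-- Quantifier-free formulas. -/
inductive MetricLanguage.Formula.IsQF {L : MetricLanguage.{u}} :
    ∀ {Γ : List L.Srt}, L.Formula Γ → Prop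
  | dist {Γ : List L.Srt} {s : L.Srt} (t t' : L.Term Γ s) : IsQF (.dist t t')
  | rel {Γ : List L.Srt} (R : L.Rel) (t : ∀ j, L.Term Γ (L.relIn R j)) : IsQF (.rel R t)
  | conn {Γ : List L.Srt} (n : ℕ) (c : C(Fin n → ℝ, ℝ)) (φ : Fin n → L.Formula Γ) :
      (∀ k, IsQF (φ k)) → IsQF (.conn n c φ)

/-- Formulas `inf_{x₁ ∈ D₁} ⋯ inf_{xₖ ∈ Dₖ} φ` with `φ` quantifier-free. -/
inductive MetricLanguage.Formula.IsExistential {L : MetricLanguage.{u}} :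
    ∀ {Γ : List L.Srt}, L.Formula Γ → Prop
  | qf {Γ : List L.Srt} {φ : L.Formula Γ} : φ.IsQF → IsExistential φ
  | inf {Γ : List L.Srt} {s : L.Srt} (D : L.Dom s) {φ : L.Formula (s :: Γ)} :
      IsExistential φ → IsExistential (.inf D φ)

/-- Values in `M` for the variables listed by `Γ`. -/
abbrev MetricStructure.Assignment {L : MetricLanguage.{u}} (M : MetricStructure.{u, w} L)
    (Γ : List L.Srt) : Type w := ∀ i : Fin Γ.length, M.carrier (Γ.get i)

def MetricStructure.Assignment.cons {L : MetricLanguage.{u}} {M : MetricStructure.{u, w} L}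
    {Γ : List L.Srt} {s : L.Srt} (x : M.carrier s) (a : M.Assignment Γ) :
    M.Assignment (s :: Γ) :=
  Fin.cons (α := fun i : Fin (Γ.length + 1) => M.carrier ((s :: Γ).get i)) x a

def MetricLanguage.Term.eval {L : MetricLanguage.{u}} (M : MetricStructure.{u, w} L)
    {Γ : List L.Srt} (a : M.Assignment Γ) : ∀ {s : L.Srt}, L.Term Γ s → M.carrier s
  | _, .var i => a i
  | _, .app f t => M.func f fun j => (t j).eval M a

/-- The value of a formula in `M`. -/
noncomputable def MetricLanguage.Formula.eval {L : MetricLanguage.{u}}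
    (M : MetricStructure.{u, w} L) :
    ∀ {Γ : List L.Srt}, L.Formula Γ → M.Assignment Γ → ℝ
  | _, .dist t t', a => Dist.dist (t.eval M a) (t'.eval M a)
  | _, .rel R t, a => M.rel R fun j => (t j).eval M a
  | _, .conn _ c φ, a => c fun k => (φ k).eval M a
  | _, .sup D φ, a => ⨆ x : M.dom D, φ.eval M (MetricStructure.Assignment.cons x.1 a)
  | _, .inf D φ, a => ⨅ x : M.dom D, φ.eval M (MetricStructure.Assignment.cons x.1 a)

/-- The class of models of the set `T` of closed conditions `σ = 0`, where `T` is given by the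
sentences `σ`. -/
def MetricStructure.Mod {L : MetricLanguage.{u}} (T : Set L.Sentence) :
    Set (MetricStructure.{u, w} L) :=
  {M | ∀ σ ∈ T, MetricLanguage.Formula.eval M σ (fun i => i.elim0) = 0}

/-- Embeddings of metric structures: maps preserving the metric, the domains and the
interpretations of all symbols. They are injective since they preserve the metric. -/
structure MetricStructure.Embedding {L : MetricLanguage.{u}}
    (M : MetricStructure.{u, w} L) (N : MetricStructure.{u, w'} L) where
  toFun : ∀ s : L.Srt, M.carrier s → N.carrier s
  map_dist : ∀ (s : L.Srt) (x y : M.carrier s), dist (toFun s x) (toFun s y) = dist x y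
  map_dom : ∀ (s : L.Srt) (D : L.Dom s), ∀ x ∈ M.dom D, toFun s x ∈ N.dom D
  map_func : ∀ (f : L.Func) (x : ∀ j, M.carrier (L.funcIn f j)),
    toFun _ (M.func f x) = N.func f fun j => toFun _ (x j)
  map_rel : ∀ (R : L.Rel) (x : ∀ j, M.carrier (L.relIn R j)),
    N.rel R (fun j => toFun _ (x j)) = M.rel R x

/-- `M` is existentially closed in its extension `i : M → N`. -/
def MetricStructure.Embedding.IsExistentiallyClosed {L : MetricLanguage.{u}}
    {M : MetricStructure.{u, w} L} {N : MetricStructure.{u, w'} L} (i : M.Embedding N) : Prop :=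
  ∀ (Γ : List L.Srt) (ψ : L.Formula Γ), ψ.IsExistential → ∀ a : M.Assignment Γ,
    ψ.eval M a = ψ.eval N fun j => i.toFun _ (a j)

/-- `A` is an existentially closed member of the class `K`. -/
def MetricStructure.IsECMember {L : MetricLanguage.{u}} (K : Set (MetricStructure.{u, w} L))
    (A : MetricStructure.{u, w} L) : Prop :=
  A ∈ K ∧ ∀ N ∈ K, ∀ i : A.Embedding N, i.IsExistentiallyClosed

/-- `A` is a strong amalgamation base for the class `K`. -/
def MetricStructure.IsStrongAmalgamationBase {L : MetricLanguage.{u}}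
    (K : Set (MetricStructure.{u, w} L)) (A : MetricStructure.{u, w} L) : Prop :=
  A ∈ K ∧ ∀ B ∈ K, ∀ C ∈ K, ∀ (i : A.Embedding B) (j : A.Embedding C),
    ∃ D ∈ K, ∃ (f : B.Embedding D) (g : C.Embedding D),
      (∀ (s : L.Srt) (a : A.carrier s), f.toFun s (i.toFun s a) = g.toFun s (j.toFun s a)) ∧
      ∀ s : L.Srt, Set.range (f.toFun s) ∩ Set.range (g.toFun s) =
        Set.range fun a : A.carrier s => f.toFun s (i.toFun s a)

/-! ### Ultraproducts -/

/-- The limit of a family of reals along an ultrafilter (meaningful for bounded families). -/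
noncomputable def ultraLim {I : Type w'} (U : Ultrafilter I) (f : I → ℝ) : ℝ :=
  limUnder (U : Filter I) f

theorem tendsto_ultraLim {I : Type w'} (U : Ultrafilter I) {f : I → ℝ} {C : ℝ}
    (h : ∀ i, |f i| ≤ C) : Tendsto f U (𝓝 (ultraLim U f)) := by
  have hc : IsCompact (Set.Icc (-C) C) := isCompact_Icc
  obtain ⟨x, -, hx⟩ := hc.ultrafilter_le_nhds (U.map f) (by
    rw [le_principal_iff]
    exact Filter.mem_map.2 (Filter.univ_mem' fun i => abs_le.1 (h i)))
  exact tendsto_nhds_limUnder ⟨x, hx⟩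

/-- Families `(xᵢ)` of elements that lie in a common domain. -/
def BoundedFamily {L : MetricLanguage.{u}} {I : Type w'} (N : I → MetricStructure.{u, w} L)
    (s : L.Srt) : Type (max w w') :=
  {x : ∀ i, (N i).carrier s // ∃ D : L.Dom s, ∀ i, x i ∈ (N i).dom D}

theorem BoundedFamily.exists_common {L : MetricLanguage.{u}} {I : Type w'}
    {N : I → MetricStructure.{u, w} L} {s : L.Srt} (x y : BoundedFamily N s) :
    ∃ D : L.Dom s, (∀ i, x.1 i ∈ (N i).dom D) ∧ ∀ i, y.1 i ∈ (N i).dom D := by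
  obtain ⟨D, hD⟩ := x.2
  obtain ⟨E, hE⟩ := y.2
  obtain ⟨F, h₁, h₂⟩ := L.dom_directed s D E
  exact ⟨F, fun i => (N i).dom_mono h₁ (hD i), fun i => (N i).dom_mono h₂ (hE i)⟩

theorem BoundedFamily.exists_bound {L : MetricLanguage.{u}} {I : Type w'}
    {N : I → MetricStructure.{u, w} L} {s : L.Srt} (x y : BoundedFamily N s) :
    ∃ C : ℝ, ∀ i, |dist (x.1 i) (y.1 i)| ≤ C := by
  obtain ⟨D, h₁, h₂⟩ := x.exists_common y
  exact ⟨L.diam D, fun i => by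
    rw [abs_of_nonneg dist_nonneg]; exact (N i).dom_diam D _ (h₁ i) _ (h₂ i)⟩

theorem BoundedFamily.tendsto_dist {L : MetricLanguage.{u}} {I : Type w'} (U : Ultrafilter I)
    {N : I → MetricStructure.{u, w} L} {s : L.Srt} (x y : BoundedFamily N s) :
    Tendsto (fun i => dist (x.1 i) (y.1 i)) U (𝓝 (ultraLim U fun i => dist (x.1 i) (y.1 i))) := by
  obtain ⟨C, hC⟩ := x.exists_bound y
  exact tendsto_ultraLim U hC

/-- The pseudometric `lim_U d(xᵢ, yᵢ)`. -/
noncomputable abbrev BoundedFamily.pseudoMetric {L : MetricLanguage.{u}} {I : Type w'}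
    (U : Ultrafilter I) (N : I → MetricStructure.{u, w} L) (s : L.Srt) :
    PseudoMetricSpace (BoundedFamily N s) where
  dist x y := ultraLim U fun i => dist (x.1 i) (y.1 i)
  dist_self x := by
    simp only [dist_self]
    exact tendsto_nhds_unique (tendsto_ultraLim U (C := 0) (by simp)) tendsto_const_nhds
  dist_comm x y := by simp only [dist_comm]
  dist_triangle x y z :=
    le_of_tendsto_of_tendsto' (x.tendsto_dist U z)
      ((x.tendsto_dist U y).add (y.tendsto_dist U z)) fun _ => dist_triangle _ _ _

/-- The sort `s` of the ultraproduct: bounded families modulo `lim_U d(xᵢ, yᵢ) = 0`. -/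
noncomputable def UltraCarrier {L : MetricLanguage.{u}} {I : Type w'} (U : Ultrafilter I)
    (N : I → MetricStructure.{u, w} L) (s : L.Srt) : Type (max w w') :=
  letI := BoundedFamily.pseudoMetric U N s
  SeparationQuotient (BoundedFamily N s)

noncomputable instance UltraCarrier.instMetricSpace {L : MetricLanguage.{u}} {I : Type w'}
    (U : Ultrafilter I) (N : I → MetricStructure.{u, w} L) (s : L.Srt) :
    MetricSpace (UltraCarrier U N s) :=
  @SeparationQuotient.instMetricSpace (BoundedFamily N s) (BoundedFamily.pseudoMetric U N s)

/-- The class of a bounded family. -/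
noncomputable def UltraCarrier.mk {L : MetricLanguage.{u}} {I : Type w'} (U : Ultrafilter I)
    {N : I → MetricStructure.{u, w} L} {s : L.Srt} (x : BoundedFamily N s) : UltraCarrier U N s :=
  letI := BoundedFamily.pseudoMetric U N s
  SeparationQuotient.mk x

theorem UltraCarrier.mk_surjective {L : MetricLanguage.{u}} {I : Type w'} (U : Ultrafilter I)
    {N : I → MetricStructure.{u, w} L} {s : L.Srt} :
    Function.Surjective (UltraCarrier.mk U : BoundedFamily N s → UltraCarrier U N s) :=
  letI := BoundedFamily.pseudoMetric U N s
  SeparationQuotient.surjective_mk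

theorem UltraCarrier.dist_mk {L : MetricLanguage.{u}} {I : Type w'} (U : Ultrafilter I)
    {N : I → MetricStructure.{u, w} L} {s : L.Srt} (x y : BoundedFamily N s) :
    dist (UltraCarrier.mk U x) (UltraCarrier.mk U y) =
      ultraLim U fun i => dist (x.1 i) (y.1 i) := rfl

theorem UltraCarrier.tendsto_dist {L : MetricLanguage.{u}} {I : Type w'} (U : Ultrafilter I)
    {N : I → MetricStructure.{u, w} L} {s : L.Srt} (x y : BoundedFamily N s) :
    Tendsto (fun i => dist (x.1 i) (y.1 i)) U
      (𝓝 (dist (UltraCarrier.mk U x) (UltraCarrier.mk U y))) := x.tendsto_dist U y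

/-- A family representing a given element of the ultraproduct. -/
noncomputable def UltraCarrier.rep {L : MetricLanguage.{u}} {I : Type w'} {U : Ultrafilter I}
    {N : I → MetricStructure.{u, w} L} {s : L.Srt} (q : UltraCarrier U N s) : BoundedFamily N s :=
  (UltraCarrier.mk_surjective U q).choose

theorem UltraCarrier.mk_rep {L : MetricLanguage.{u}} {I : Type w'} {U : Ultrafilter I}
    {N : I → MetricStructure.{u, w} L} {s : L.Srt} (q : UltraCarrier U N s) :
    UltraCarrier.mk U q.rep = q :=
  (UltraCarrier.mk_surjective U q).choose_spec

/-- Coordinatewise application of a function symbol to bounded families. -/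
def BoundedFamily.func {L : MetricLanguage.{u}} {I : Type w'} {N : I → MetricStructure.{u, w} L}
    (f : L.Func) (x : ∀ j, BoundedFamily N (L.funcIn f j)) : BoundedFamily N (L.funcOut f) :=
  ⟨fun i => (N i).func f fun j => (x j).1 i, by
    choose D hD using fun j => (x j).2
    exact ⟨L.funcDom f D, fun i => (N i).func_mem f D _ fun j => hD j i⟩⟩

theorem BoundedFamily.dist_func_le {L : MetricLanguage.{u}} {I : Type w'} (U : Ultrafilter I)
    {N : I → MetricStructure.{u, w} L} (f : L.Func) (D : ∀ j, L.Dom (L.funcIn f j))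
    (x y : ∀ j, BoundedFamily N (L.funcIn f j))
    (hx : ∀ j i, (x j).1 i ∈ (N i).dom (D j)) (hy : ∀ j i, (y j).1 i ∈ (N i).dom (D j))
    (ε : ℝ) (hε : 0 < ε)
    (h : ∀ j, dist (UltraCarrier.mk U (x j)) (UltraCarrier.mk U (y j)) < L.funcMod f D ε) :
    dist (UltraCarrier.mk U (func f x)) (UltraCarrier.mk U (func f y)) ≤ ε := by
  have h' : ∀ᶠ i in (U : Filter I), ∀ j, dist ((x j).1 i) ((y j).1 i) < L.funcMod f D ε :=
    Filter.eventually_all.2 fun j =>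
      (UltraCarrier.tendsto_dist U (x j) (y j)).eventually_lt_const (h j)
  exact le_of_tendsto (UltraCarrier.tendsto_dist U _ _)
    (h'.mono fun i hi => (N i).func_unif f D ε hε _ _ (fun j => hx j i) (fun j => hy j i) hi)

theorem BoundedFamily.tendsto_rel {L : MetricLanguage.{u}} {I : Type w'} (U : Ultrafilter I)
    {N : I → MetricStructure.{u, w} L} (R : L.Rel) (x : ∀ j, BoundedFamily N (L.relIn R j)) :
    Tendsto (fun i => (N i).rel R fun j => (x j).1 i) U
      (𝓝 (ultraLim U fun i => (N i).rel R fun j => (x j).1 i)) := by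
  choose D hD using fun j => (x j).2
  exact tendsto_ultraLim U fun i => (N i).rel_bound R D _ fun j => hD j i

theorem BoundedFamily.abs_rel_sub_le {L : MetricLanguage.{u}} {I : Type w'} (U : Ultrafilter I)
    {N : I → MetricStructure.{u, w} L} (R : L.Rel) (D : ∀ j, L.Dom (L.relIn R j))
    (x y : ∀ j, BoundedFamily N (L.relIn R j))
    (hx : ∀ j i, (x j).1 i ∈ (N i).dom (D j)) (hy : ∀ j i, (y j).1 i ∈ (N i).dom (D j))
    (ε : ℝ) (hε : 0 < ε)
    (h : ∀ j, dist (UltraCarrier.mk U (x j)) (UltraCarrier.mk U (y j)) < L.relMod R D ε) :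
    |(ultraLim U fun i => (N i).rel R fun j => (x j).1 i) -
      ultraLim U fun i => (N i).rel R fun j => (y j).1 i| ≤ ε := by
  have h' : ∀ᶠ i in (U : Filter I), ∀ j, dist ((x j).1 i) ((y j).1 i) < L.relMod R D ε :=
    Filter.eventually_all.2 fun j =>
      (UltraCarrier.tendsto_dist U (x j) (y j)).eventually_lt_const (h j)
  exact le_of_tendsto ((tendsto_rel U R x).sub (tendsto_rel U R y)).abs
    (h'.mono fun i hi => (N i).rel_unif R D ε hε _ _ (fun j => hx j i) (fun j => hy j i) hi)

theorem BoundedFamily.exists_common_pi {L : MetricLanguage.{u}} {I : Type w'}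
    {N : I → MetricStructure.{u, w} L} {n : ℕ} {σ : Fin n → L.Srt}
    (x y : ∀ j, BoundedFamily N (σ j)) :
    ∃ D : ∀ j, L.Dom (σ j), (∀ j i, (x j).1 i ∈ (N i).dom (D j)) ∧
      ∀ j i, (y j).1 i ∈ (N i).dom (D j) := by
  choose D h₁ h₂ using fun j => (x j).exists_common (y j)
  exact ⟨D, h₁, h₂⟩

/-- The symbols are well defined on classes of bounded families. -/
theorem UltraCarrier.mk_func_congr {L : MetricLanguage.{u}} {I : Type w'} (U : Ultrafilter I)
    {N : I → MetricStructure.{u, w} L} (f : L.Func) (x y : ∀ j, BoundedFamily N (L.funcIn f j))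
    (h : ∀ j, UltraCarrier.mk U (x j) = UltraCarrier.mk U (y j)) :
    UltraCarrier.mk U (BoundedFamily.func f x) = UltraCarrier.mk U (BoundedFamily.func f y) := by
  obtain ⟨D, hx, hy⟩ := BoundedFamily.exists_common_pi x y
  refine dist_le_zero.1 (le_of_forall_pos_le_add fun ε hε => ?_)
  rw [zero_add]
  refine BoundedFamily.dist_func_le U f D x y hx hy ε hε fun j => ?_
  rw [h j, dist_self]
  exact L.funcMod_pos f D ε hε

theorem UltraCarrier.rel_congr {L : MetricLanguage.{u}} {I : Type w'} (U : Ultrafilter I)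
    {N : I → MetricStructure.{u, w} L} (R : L.Rel) (x y : ∀ j, BoundedFamily N (L.relIn R j))
    (h : ∀ j, UltraCarrier.mk U (x j) = UltraCarrier.mk U (y j)) :
    (ultraLim U fun i => (N i).rel R fun j => (x j).1 i) =
      ultraLim U fun i => (N i).rel R fun j => (y j).1 i := by
  obtain ⟨D, hx, hy⟩ := BoundedFamily.exists_common_pi x y
  refine sub_eq_zero.1 (abs_nonpos_iff.1 (le_of_forall_pos_le_add fun ε hε => ?_))
  rw [zero_add]
  refine BoundedFamily.abs_rel_sub_le U R D x y hx hy ε hε fun j => ?_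
  rw [h j, dist_self]
  exact L.relMod_pos R D ε hε

/-- The domains of the ultraproduct: classes of families lying in the given domain. -/
def UltraCarrier.dom {L : MetricLanguage.{u}} {I : Type w'} (U : Ultrafilter I)
    (N : I → MetricStructure.{u, w} L) {s : L.Srt} (D : L.Dom s) : Set (UltraCarrier U N s) :=
  {q | ∃ x : BoundedFamily N s, (∀ i, x.1 i ∈ (N i).dom D) ∧ UltraCarrier.mk U x = q}

theorem UltraCarrier.exists_limit {α : Type w} [MetricSpace α] {S : Set α} (hS : IsComplete S)
    (x : ℕ → α) (hx : ∀ n, x n ∈ S) :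
    ∃ y ∈ S, ∀ n, (∀ k < n, dist (x k) (x (k + 1)) < 2 / 2 / 2 ^ k) → dist (x n) y ≤ 2 / 2 ^ n := by
  classical
  let P : ℕ → Prop := fun n => ∀ k < n, dist (x k) (x (k + 1)) < 2 / 2 / 2 ^ k
  let z : ℕ → α := fun n => Nat.rec (x 0) (fun m y => if P (m + 1) then x (m + 1) else y) n
  have zs : ∀ n, z (n + 1) = if P (n + 1) then x (n + 1) else z n := fun n => rfl
  have hP : ∀ n, P (n + 1) → P n := fun n h k hk => h k (hk.trans n.lt_succ_self)
  have hzP : ∀ n, P n → z n = x n := by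
    rintro (_ | n) h
    · rfl
    · rw [zs, if_pos h]
  have hzS : ∀ n, z n ∈ S := by
    intro n
    induction n with
    | zero => exact hx 0
    | succ n ih => rw [zs]; split_ifs; exacts [hx _, ih]
  have hz : ∀ n, dist (z n) (z (n + 1)) ≤ 2 / 2 / 2 ^ n := by
    intro n
    rw [zs]
    split_ifs with h
    · rw [hzP n (hP n h)]
      exact (h n n.lt_succ_self).le
    · rw [dist_self]; positivity
  obtain ⟨y, hyS, hy⟩ := cauchySeq_tendsto_of_isComplete hS hzS (cauchySeq_of_le_geometric_two hz)
  refine ⟨y, hyS, fun n hn => ?_⟩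
  rw [← hzP n hn]
  exact dist_le_of_le_geometric_two_of_tendsto hz hy n

theorem UltraCarrier.isComplete_dom {L : MetricLanguage.{u}} {I : Type w'} (U : Ultrafilter I)
    (N : I → MetricStructure.{u, w} L) {s : L.Srt} (D : L.Dom s) :
    IsComplete (UltraCarrier.dom U N D) := by
  rw [← completeSpace_coe_iff_isComplete]
  refine Metric.complete_of_convergent_controlled_sequences (fun n => 2 / 2 / 2 ^ n)
    (fun n => by positivity) fun v hv => ?_
  choose x hxD hx using fun n => (v n).2
  choose y hyD hy using fun i =>
    UltraCarrier.exists_limit ((N i).dom_complete D) (fun n => (x n).1 i) fun n => hxD n i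
  let yb : BoundedFamily N s := ⟨y, D, hyD⟩
  refine ⟨⟨UltraCarrier.mk U yb, yb, hyD, rfl⟩, ?_⟩
  have key : ∀ n, dist (UltraCarrier.mk U (x n)) (UltraCarrier.mk U yb) ≤ 2 / 2 ^ n := by
    intro n
    refine le_of_tendsto (UltraCarrier.tendsto_dist U (x n) yb) ?_
    have : ∀ᶠ i in (U : Filter I), ∀ k ∈ Finset.range n,
        dist ((x k).1 i) ((x (k + 1)).1 i) < 2 / 2 / 2 ^ k := by
      refine (Filter.eventually_all_finset _).2 fun k _ => ?_
      refine (UltraCarrier.tendsto_dist U (x k) (x (k + 1))).eventually_lt_const ?_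
      rw [hx, hx]
      exact hv k k (k + 1) le_rfl k.le_succ
    exact this.mono fun i hi => hy i n fun k hk => hi k (Finset.mem_range.2 hk)
  rw [tendsto_iff_dist_tendsto_zero]
  have h2 : Tendsto (fun n : ℕ => (2 : ℝ) / 2 ^ n) atTop (𝓝 0) := by
    have := (tendsto_pow_atTop_nhds_zero_of_lt_one (r := (1 / 2 : ℝ)) (by norm_num)
      (by norm_num)).const_mul 2
    rw [mul_zero] at this
    refine this.congr fun n => ?_
    rw [one_div, inv_pow, div_eq_mul_inv]
  refine squeeze_zero (fun _ => dist_nonneg) (fun n => ?_) h2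
  have := key n
  rw [hx] at this
  exact this

/-- The metric ultraproduct of a family of structures. -/
noncomputable def MetricStructure.ultraproduct {L : MetricLanguage.{u}} {I : Type w'}
    (U : Ultrafilter I) (N : I → MetricStructure.{u, w} L) :
    MetricStructure.{u, max w w'} L where
  carrier := UltraCarrier U N
  metric := UltraCarrier.instMetricSpace U N
  dom D := UltraCarrier.dom U N D
  dom_nonempty D := by
    choose x hx using fun i => (N i).dom_nonempty D
    exact ⟨_, ⟨x, D, hx⟩, hx, rfl⟩
  dom_mono h := by
    rintro _ ⟨x, hx, rfl⟩
    exact ⟨x, fun i => (N i).dom_mono h (hx i), rfl⟩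
  dom_cover q := by
    obtain ⟨D, hD⟩ := q.rep.2
    exact ⟨D, q.rep, hD, q.mk_rep⟩
  dom_complete D := UltraCarrier.isComplete_dom U N D
  dom_diam := by
    rintro s D _ ⟨x, hx, rfl⟩ _ ⟨y, hy, rfl⟩
    exact le_of_tendsto' (UltraCarrier.tendsto_dist U x y)
      fun i => (N i).dom_diam D _ (hx i) _ (hy i)
  func f q := UltraCarrier.mk U (BoundedFamily.func f fun j => (q j).rep)
  func_mem f D q hq := by
    choose x hxD hx using hq
    exact ⟨BoundedFamily.func f x, fun i => (N i).func_mem f D _ fun j => hxD j i,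
      UltraCarrier.mk_func_congr U f _ _ fun j => by rw [hx, UltraCarrier.mk_rep]⟩
  func_unif f D ε hε q r hq hr h := by
    choose x hxD hx using hq
    choose y hyD hy using hr
    rw [UltraCarrier.mk_func_congr U f (fun j => (q j).rep) x fun j => by
        rw [hx, UltraCarrier.mk_rep],
      UltraCarrier.mk_func_congr U f (fun j => (r j).rep) y fun j => by
        rw [hy, UltraCarrier.mk_rep]]
    exact BoundedFamily.dist_func_le U f D x y hxD hyD ε hε fun j => by rw [hx, hy]; exact h j
  rel R q := ultraLim U fun i => (N i).rel R fun j => (q j).rep.1 i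
  rel_bound R D q hq := by
    choose x hxD hx using hq
    rw [UltraCarrier.rel_congr U R (fun j => (q j).rep) x fun j => by
        rw [hx, UltraCarrier.mk_rep]]
    exact le_of_tendsto' (BoundedFamily.tendsto_rel U R x).abs
      fun i => (N i).rel_bound R D _ fun j => hxD j i
  rel_unif R D ε hε q r hq hr h := by
    choose x hxD hx using hq
    choose y hyD hy using hr
    rw [UltraCarrier.rel_congr U R (fun j => (q j).rep) x fun j => by
        rw [hx, UltraCarrier.mk_rep],
      UltraCarrier.rel_congr U R (fun j => (r j).rep) y fun j => by
        rw [hy, UltraCarrier.mk_rep]]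
    exact BoundedFamily.abs_rel_sub_le U R D x y hxD hyD ε hε fun j => by
      rw [hx, hy]; exact h j

/-! ## Tracial von Neumann algebras -/

/-- A tracial von Neumann algebra: a von Neumann algebra of operators on a Hilbert space `H` with a
faithful normal tracial state. Normality is ultraweak continuity: the trace has the form
`x ↦ ∑ₙ ⟪ηₙ, x ξₙ⟫` with `∑ₙ ‖ξₙ‖² < ∞` and `∑ₙ ‖ηₙ‖² < ∞`. -/
structure TracialVNA : Type (w + 1) where
  H : Type w
  [instNormed : NormedAddCommGroup H]
  [instInner : InnerProductSpace ℂ H]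
  [instComplete : CompleteSpace H]
  alg : VonNeumannAlgebra H
  tr : alg.toStarSubalgebra →ₗ[ℂ] ℂ
  tr_one : tr 1 = 1
  tr_nonneg : ∀ x, ∃ r : ℝ, 0 ≤ r ∧ tr (star x * x) = r
  tr_faithful : ∀ x, tr (star x * x) = 0 → x = 0
  tr_comm : ∀ x y, tr (x * y) = tr (y * x)
  tr_normal : ∃ ξ η : ℕ → H, (Summable fun n => ‖ξ n‖ ^ 2) ∧ (Summable fun n => ‖η n‖ ^ 2) ∧
    ∀ x : alg.toStarSubalgebra, HasSum (fun n => inner ℂ (η n) (x.1 (ξ n))) (tr x)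

attribute [instance] TracialVNA.instNormed TracialVNA.instInner TracialVNA.instComplete

/-- The elements of `M`; this type carries the `2`-norm, not the operator norm. -/
def TracialVNA.Elem (M : TracialVNA.{w}) : Type w := M.alg.toStarSubalgebra

noncomputable instance TracialVNA.instRing (M : TracialVNA.{w}) :
    Ring M.Elem := inferInstanceAs (Ring M.alg.toStarSubalgebra)
noncomputable instance TracialVNA.instStarRing (M : TracialVNA.{w}) :
    StarRing M.Elem :=
  inferInstanceAs (StarRing M.alg.toStarSubalgebra)
noncomputable instance TracialVNA.instAlgebra (M : TracialVNA.{w}) :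
    Algebra ℂ M.Elem :=
  inferInstanceAs (Algebra ℂ M.alg.toStarSubalgebra)
instance TracialVNA.instStarModule (M : TracialVNA.{w}) :
    StarModule ℂ M.Elem :=
  inferInstanceAs (StarModule ℂ M.alg.toStarSubalgebra)

/-- The operator underlying an element. -/
def TracialVNA.Elem.op {M : TracialVNA.{w}} (x : M.Elem) : M.H →L[ℂ] M.H := Subtype.val x

/-- The trace. -/
def TracialVNA.trace (M : TracialVNA.{w}) : M.Elem →ₗ[ℂ] ℂ := M.tr

theorem TracialVNA.op_mem {M : TracialVNA.{w}} (x : M.Elem) : x.op ∈ M.alg := x.2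
theorem TracialVNA.op_injective {M : TracialVNA.{w}} {x y : M.Elem} (h : x.op = y.op) : x = y :=
  Subtype.ext h
theorem TracialVNA.op_one {M : TracialVNA.{w}} : (1 : M.Elem).op = 1 := rfl
theorem TracialVNA.op_zero {M : TracialVNA.{w}} : (0 : M.Elem).op = 0 := rfl
theorem TracialVNA.op_add {M : TracialVNA.{w}} (x y : M.Elem) : (x + y).op = x.op + y.op := rfl
theorem TracialVNA.op_sub {M : TracialVNA.{w}} (x y : M.Elem) : (x - y).op = x.op - y.op := rfl
theorem TracialVNA.op_mul {M : TracialVNA.{w}} (x y : M.Elem) : (x * y).op = x.op * y.op := rfl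
theorem TracialVNA.op_star {M : TracialVNA.{w}} (x : M.Elem) : (star x).op = star x.op := rfl
theorem TracialVNA.op_smul {M : TracialVNA.{w}} (c : ℂ) (x : M.Elem) :
    (c • x).op = c • x.op := rfl

theorem TracialVNA.trace_star_mul_self (M : TracialVNA.{w}) (x : M.Elem) :
    0 ≤ (M.trace (star x * x)).re ∧ (M.trace (star x * x)).im = 0 := by
  obtain ⟨r, hr, h⟩ := M.tr_nonneg x
  have h' : M.trace (star x * x) = r := h
  rw [h']
  exact ⟨by simpa using hr, by simp⟩

/-- Positive functionals are hermitian. -/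
theorem TracialVNA.trace_star (M : TracialVNA.{w}) (x : M.Elem) :
    M.trace (star x) = starRingEnd ℂ (M.trace x) := by
  have h1 := (M.trace_star_mul_self (1 + x)).2
  have h2 := (M.trace_star_mul_self (1 + Complex.I • x)).2
  have h3 := (M.trace_star_mul_self x).2
  have h4 : (M.trace 1) = 1 := M.tr_one
  have e1 : star (1 + x) * (1 + x) = 1 + x + star x + star x * x := by
    rw [star_add, star_one]; noncomm_ring
  have e2 : star (1 + Complex.I • x) * (1 + Complex.I • x) =
      1 + Complex.I • x - Complex.I • star x + star x * x := by
    rw [star_add, star_one, star_smul, Complex.star_def, Complex.conj_I, add_mul, mul_add, mul_add,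
      one_mul, one_mul, mul_one, smul_mul_smul_comm]
    simp only [neg_mul, Complex.I_mul_I, neg_neg, one_smul, neg_smul]
    abel
  rw [e1, map_add, map_add, map_add, h4] at h1
  rw [e2, map_add, map_sub, map_add, map_smul, map_smul, h4] at h2
  simp at h1 h2
  apply Complex.ext
  · simp; linarith
  · simp; linarith

/-- The inner product `⟪x, y⟫ = tr (x* y)`. -/
noncomputable abbrev TracialVNA.innerCore (M : TracialVNA.{w}) :
    InnerProductSpace.Core ℂ M.Elem where
  inner x y := M.trace (star x * y)
  conj_inner_symm x y := by
    show starRingEnd ℂ (M.trace (star y * x)) = M.trace (star x * y)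
    rw [← M.trace_star, star_mul, star_star]
  re_inner_nonneg x := (M.trace_star_mul_self x).1
  add_left x y z := by
    show M.trace (star (x + y) * z) = M.trace (star x * z) + M.trace (star y * z)
    rw [star_add, add_mul, map_add]
  smul_left x y c := by
    show M.trace (star (c • x) * y) = starRingEnd ℂ c * M.trace (star x * y)
    rw [star_smul, smul_mul_assoc, map_smul, smul_eq_mul]; rfl
  definite x h := M.tr_faithful x h

noncomputable instance TracialVNA.instNormedElem (M : TracialVNA.{w}) : NormedAddCommGroup M.Elem :=
  M.innerCore.toNormedAddCommGroup

noncomputable instance TracialVNA.instInnerElem (M : TracialVNA.{w}) : InnerProductSpace ℂ M.Elem :=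
  InnerProductSpace.ofCore M.innerCore.toCore

theorem TracialVNA.inner_def (M : TracialVNA.{w}) (x y : M.Elem) :
    inner ℂ x y = M.trace (star x * y) := rfl

theorem TracialVNA.norm_def (M : TracialVNA.{w}) (x : M.Elem) :
    ‖x‖ = Real.sqrt (M.trace (star x * x)).re := rfl

theorem TracialVNA.norm_star (M : TracialVNA.{w}) (x : M.Elem) : ‖star x‖ = ‖x‖ := by
  have : M.trace (x * star x) = M.trace (star x * x) := M.tr_comm _ _
  rw [M.norm_def, M.norm_def, star_star, this]

theorem TracialVNA.norm_sq (M : TracialVNA.{w}) (x : M.Elem) :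
    ‖x‖ ^ 2 = (M.trace (star x * x)).re := by
  rw [M.norm_def, Real.sq_sqrt (M.trace_star_mul_self x).1]

theorem TracialVNA.norm_one' (M : TracialVNA.{w}) : ‖(1 : M.Elem)‖ = 1 := by
  have h4 : (M.trace 1) = 1 := M.tr_one
  rw [M.norm_def, star_one, one_mul, h4]; simp

/-- An operator commuting with the commutant belongs to the algebra. -/
theorem TracialVNA.exists_elem (M : TracialVNA.{w}) (T : M.H →L[ℂ] M.H)
    (hT : ∀ z ∈ M.alg.commutant, z * T = T * z) : ∃ x : M.Elem, x.op = T := by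
  have : T ∈ M.alg.commutant.commutant := VonNeumannAlgebra.mem_commutant_iff.2 hT
  rw [VonNeumannAlgebra.commutant_commutant] at this
  exact ⟨⟨T, this⟩, rfl⟩

open scoped ComplexOrder in
/-- `r² - x* x` is of the form `y* y` as soon as the operator norm of `x` is at most `r`. -/
theorem TracialVNA.exists_sub_eq (M : TracialVNA.{w}) (x : M.Elem) (r : ℝ) (hx : ‖x.op‖ ≤ r) :
    ∃ y : M.Elem, ((r : ℂ) ^ 2) • (1 : M.Elem) - star x * x = star y * y := by
  set a : M.H →L[ℂ] M.H := algebraMap ℝ (M.H →L[ℂ] M.H) (r ^ 2) - star x.op * x.op with ha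
  have hr : 0 ≤ r := (norm_nonneg _).trans hx
  have ha0 : 0 ≤ a := by
    rw [sub_nonneg]
    refine CStarAlgebra.star_mul_le_algebraMap_norm_sq.trans ?_
    exact algebraMap_mono _ (by gcongr)
  have hcomm : ∀ z ∈ M.alg.commutant, Commute z (CFC.sqrt a) := by
    intro z hz
    have h1 : x.op * z = z * x.op := VonNeumannAlgebra.mem_commutant_iff.1 hz _ (M.op_mem x)
    have h2 : star x.op * z = z * star x.op :=
      VonNeumannAlgebra.mem_commutant_iff.1 hz _ (M.op_mem (star x))
    have h3 : Commute a z := by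
      refine Commute.sub_left (Algebra.commutes _ _) ?_
      show star x.op * x.op * z = z * (star x.op * x.op)
      rw [mul_assoc, h1, ← mul_assoc, h2, mul_assoc]
    exact (Commute.cfcₙ_nnreal h3 NNReal.sqrt).symm
  obtain ⟨y, hy⟩ := M.exists_elem (CFC.sqrt a) fun z hz => hcomm z hz
  refine ⟨y, TracialVNA.op_injective ?_⟩
  have hs : star (CFC.sqrt a) = CFC.sqrt a := (CFC.sqrt_nonneg a).isSelfAdjoint.star_eq
  rw [TracialVNA.op_mul, TracialVNA.op_star, hy, hs, CFC.sqrt_mul_sqrt_self a ha0, ha,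
    TracialVNA.op_sub, TracialVNA.op_smul, TracialVNA.op_mul, TracialVNA.op_star,
    TracialVNA.op_one, Algebra.algebraMap_eq_smul_one]
  congr 1
  ext v
  simp [← Complex.coe_smul]

theorem TracialVNA.norm_mul_le_left (M : TracialVNA.{w}) (x y : M.Elem) (r : ℝ)
    (hx : ‖x.op‖ ≤ r) : ‖x * y‖ ≤ r * ‖y‖ := by
  have hr : 0 ≤ r := (norm_nonneg _).trans hx
  obtain ⟨z, hz⟩ := M.exists_sub_eq x r hx
  refine abs_le_of_sq_le_sq' ?_ (by positivity) |>.2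
  rw [mul_pow, M.norm_sq, M.norm_sq]
  have h := (M.trace_star_mul_self (z * y)).1
  have e : star (z * y) * (z * y) =
      ((r : ℂ) ^ 2) • (star y * y) - star (x * y) * (x * y) := by
    rw [star_mul, star_mul, mul_assoc, ← mul_assoc (star z), ← hz, sub_mul, mul_sub, smul_mul_assoc,
      one_mul, mul_smul_comm]
    simp only [mul_assoc]
  rw [e, map_sub, map_smul, smul_eq_mul, ← Complex.ofReal_pow, Complex.sub_re,
    Complex.re_ofReal_mul] at h
  linarith

theorem TracialVNA.norm_mul_le_right (M : TracialVNA.{w}) (x y : M.Elem) (r : ℝ)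
    (hy : ‖y.op‖ ≤ r) : ‖x * y‖ ≤ r * ‖x‖ := by
  rw [← M.norm_star, star_mul, ← M.norm_star x]
  refine M.norm_mul_le_left _ _ r ?_
  rwa [TracialVNA.op_star, _root_.norm_star]

theorem TracialVNA.norm_le (M : TracialVNA.{w}) (x : M.Elem) (r : ℝ) (hx : ‖x.op‖ ≤ r) :
    ‖x‖ ≤ r := by
  simpa [M.norm_one'] using M.norm_mul_le_left x 1 r hx

theorem TracialVNA.norm_trace_le (M : TracialVNA.{w}) (x : M.Elem) : ‖M.trace x‖ ≤ ‖x‖ := by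
  have := norm_inner_le_norm (𝕜 := ℂ) (1 : M.Elem) x
  rwa [M.inner_def, star_one, one_mul, M.norm_one', one_mul] at this

/-- The operator-norm ball of radius `n`. -/
def TracialVNA.opBall (M : TracialVNA.{w}) (n : ℕ) : Set M.Elem := {x | ‖x.op‖ ≤ n}

/-- A sequence in an operator-norm ball has a limit point in the weak operator topology. -/
theorem TracialVNA.exists_weak_limit (M : TracialVNA.{w}) (U : Ultrafilter ℕ) (r : ℝ)
    (x : ℕ → M.Elem) (hx : ∀ n, ‖(x n).op‖ ≤ r) :
    ∃ y : M.Elem, ‖y.op‖ ≤ r ∧ ∀ v v' : M.H,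
      Tendsto (fun n => inner ℂ v ((x n).op v')) U (𝓝 (inner ℂ v (y.op v'))) := by
  have hr : 0 ≤ r := (norm_nonneg _).trans (hx 0)
  have hbd : ∀ v v' n, ‖inner ℂ ((x n).op v) v'‖ ≤ r * ‖v‖ * ‖v'‖ := fun v v' n =>
    (norm_inner_le_norm _ _).trans (by
      gcongr; exact (ContinuousLinearMap.le_opNorm _ _).trans (by gcongr; exact hx n))
  have hlim : ∀ v v', ∃ c : ℂ, Tendsto (fun n => inner ℂ ((x n).op v) v') U (𝓝 c) := by
    intro v v'
    obtain ⟨c, -, hc⟩ := (isCompact_closedBall (0 : ℂ) (r * ‖v‖ * ‖v'‖)).ultrafilter_le_nhds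
      (U.map fun n => inner ℂ ((x n).op v) v') (by
        rw [le_principal_iff]
        exact Filter.mem_map.2 (Filter.univ_mem' fun n => by
          simpa using hbd v v' n))
    exact ⟨c, hc⟩
  choose b hb using hlim
  let B : M.H →L⋆[ℂ] M.H →L[ℂ] ℂ := LinearMap.mkContinuous₂
    (LinearMap.mk₂'ₛₗ (starRingEnd ℂ) (RingHom.id ℂ) b
      (fun v v₁ v' => tendsto_nhds_unique (hb _ _) (by
        simpa only [map_add, inner_add_left] using (hb v v').add (hb v₁ v')))
      (fun c v v' => tendsto_nhds_unique (hb _ _) (by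
        simpa only [map_smul, inner_smul_left, smul_eq_mul] using
          (hb v v').const_mul (starRingEnd ℂ c)))
      (fun v v' v₁ => tendsto_nhds_unique (hb _ _) (by
        simpa only [inner_add_right] using (hb v v').add (hb v v₁)))
      (fun c v v' => tendsto_nhds_unique (hb _ _) (by
        simpa only [inner_smul_right, smul_eq_mul, RingHom.id_apply] using
          (hb v v').const_mul c))) r
    fun v v' => le_of_tendsto' (hb v v').norm (hbd v v')
  have hBb : ∀ v v', B v v' = b v v' := fun _ _ => rfl
  let T : M.H →L[ℂ] M.H := InnerProductSpace.continuousLinearMapOfBilin B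
  have hT : ∀ v v', inner ℂ (T v) v' = b v v' := fun v v' => by
    rw [InnerProductSpace.continuousLinearMapOfBilin_apply, hBb]
  have hTn : ‖T‖ ≤ r := by
    refine ContinuousLinearMap.opNorm_le_bound _ hr fun v => ?_
    rcases eq_or_ne (T v) 0 with h0 | h0
    · rw [h0, norm_zero]; positivity
    have h1 : ‖inner ℂ (T v) (T v)‖ ≤ r * ‖v‖ * ‖T v‖ := by
      rw [hT]
      exact le_of_tendsto' (hb v (T v)).norm (hbd v (T v))
    rw [inner_self_eq_norm_sq_to_K, norm_pow, sq] at h1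
    simp only [Complex.coe_algebraMap, Complex.norm_real, norm_norm] at h1
    exact le_of_mul_le_mul_right h1 (norm_pos_iff.2 h0)
  obtain ⟨y, hy⟩ := M.exists_elem T fun z hz => by
    ext v
    refine ext_inner_right ℂ fun v' => ?_
    show inner ℂ (z (T v)) v' = inner ℂ (T (z v)) v'
    rw [← ContinuousLinearMap.adjoint_inner_right, hT, hT]
    refine tendsto_nhds_unique (hb _ _) ((hb (z v) v').congr fun n => ?_)
    rw [ContinuousLinearMap.adjoint_inner_right]
    have h1 : (x n).op * z = z * (x n).op :=
      VonNeumannAlgebra.mem_commutant_iff.1 hz _ (M.op_mem (x n))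
    exact congrArg (fun S : M.H →L[ℂ] M.H => inner ℂ (S v) v') h1
  refine ⟨y, hy ▸ hTn, fun v v' => ?_⟩
  rw [hy]
  have := (Complex.continuous_conj.tendsto _).comp (hb v' v)
  rw [← hT, inner_conj_symm] at this
  exact this.congr fun n => inner_conj_symm _ _

/-- Operator-norm balls are complete in the `2`-norm. -/
theorem TracialVNA.isComplete_opBall (M : TracialVNA.{w}) (k : ℕ) : IsComplete (M.opBall k) := by
  set r : ℝ := (k : ℝ)
  rw [← completeSpace_coe_iff_isComplete]
  refine Metric.complete_of_cauchySeq_tendsto fun u hu => ?_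
  let x : ℕ → M.Elem := fun n => (u n).1
  have hx : ∀ n, ‖(x n).op‖ ≤ r := fun n => (u n).2
  let U : Ultrafilter ℕ := Filter.hyperfilter ℕ
  have hU : (U : Filter ℕ) ≤ atTop := Nat.hyperfilter_le_atTop
  obtain ⟨y, hyr, hy⟩ := M.exists_weak_limit U r x hx
  have htr : ∀ z : M.Elem, Tendsto (fun n => M.trace (star z * x n)) U
      (𝓝 (M.trace (star z * y))) := by
    intro z
    obtain ⟨ξ, η, hξ, hη, h⟩ := M.tr_normal
    have e : ∀ t : M.Elem, M.trace (star z * t) = ∑' m, inner ℂ (z.op (η m)) (t.op (ξ m)) := by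
      intro t
      rw [show M.trace (star z * t) = M.tr (star z * t) from rfl, ← (h (star z * t)).tsum_eq]
      refine tsum_congr fun m => ?_
      exact ContinuousLinearMap.adjoint_inner_right z.op _ _
    simp only [e]
    refine tendsto_tsum_of_dominated_convergence
      (bound := fun m => ‖z.op‖ * r * ‖η m‖ ^ 2 + ‖z.op‖ * r * ‖ξ m‖ ^ 2)
      ((hη.mul_left _).add (hξ.mul_left _)) (fun m => hy _ _)
      (Filter.Eventually.of_forall fun n m => ?_)
    have hr : 0 ≤ r := (norm_nonneg _).trans (hx 0)
    calc ‖inner ℂ (z.op (η m)) ((x n).op (ξ m))‖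
        ≤ ‖z.op (η m)‖ * ‖(x n).op (ξ m)‖ := norm_inner_le_norm _ _
      _ ≤ (‖z.op‖ * ‖η m‖) * (r * ‖ξ m‖) := by
          gcongr
          · exact ContinuousLinearMap.le_opNorm _ _
          · exact (ContinuousLinearMap.le_opNorm _ _).trans (by gcongr; exact hx n)
      _ = ‖z.op‖ * r * (‖η m‖ * ‖ξ m‖) := by ring
      _ ≤ ‖z.op‖ * r * (‖η m‖ ^ 2 + ‖ξ m‖ ^ 2) := by
          gcongr
          nlinarith [sq_nonneg (‖η m‖ - ‖ξ m‖), sq_nonneg ‖η m‖, sq_nonneg ‖ξ m‖]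
      _ = _ := by ring
  refine ⟨⟨y, hyr⟩, Metric.tendsto_atTop.2 fun ε hε => ?_⟩
  obtain ⟨N, hN⟩ := Metric.cauchySeq_iff.1 hu (ε / 2) (by positivity)
  refine ⟨N, fun m hm => ?_⟩
  show dist (x m) y < ε
  rw [dist_eq_norm]
  have hlim : Tendsto (fun n => inner ℂ (x m - y) (x m - x n)) U
      (𝓝 (inner ℂ (x m - y) (x m - y))) := by
    simp only [inner_sub_right (x m - y)]
    exact tendsto_const_nhds.sub (htr (x m - y))
  have hle : ‖inner ℂ (x m - y) (x m - y)‖ ≤ ‖x m - y‖ * (ε / 2) := by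
    refine le_of_tendsto hlim.norm (Filter.Eventually.mono (Filter.Eventually.filter_mono hU (eventually_ge_atTop N)) fun n hn => ?_)
    refine (norm_inner_le_norm _ _).trans ?_
    gcongr
    rw [← dist_eq_norm]
    exact (hN m hm n hn).le
  rw [inner_self_eq_norm_sq_to_K, norm_pow, sq] at hle
  simp only [Complex.coe_algebraMap, Complex.norm_real, norm_norm] at hle
  rcases eq_or_ne (‖x m - y‖) 0 with h0 | h0
  · rw [h0]; exact hε
  · have := le_of_mul_le_mul_left hle (lt_of_le_of_ne (norm_nonneg _) (Ne.symm h0))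
    linarith

/-- Function symbols of the language of tracial von Neumann algebras. -/
inductive TracialFunc : Type
  | zero | one | add | mul | star
  | smul (c : ℂ)

/-- Predicate symbols of the language of tracial von Neumann algebras: the real and the imaginary
part of the trace. -/
inductive TracialRel : Type
  | trRe | trIm

def TracialFunc.arity : TracialFunc → ℕ
  | zero => 0
  | one => 0
  | add => 2
  | mul => 2
  | star => 1
  | smul _ => 1

/-- The operation maps the operator-norm balls of radii `D j` into the ball of this radius. -/
noncomputable def TracialFunc.radius : ∀ f : TracialFunc, (Fin f.arity → ℕ) → ℕ
  | zero, _ => 0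
  | one, _ => 1
  | add, D => D (0 : Fin 2) + D (1 : Fin 2)
  | mul, D => D (0 : Fin 2) * D (1 : Fin 2)
  | star, D => D (0 : Fin 1)
  | smul c, D => ⌈‖c‖⌉₊ * D (0 : Fin 1)

noncomputable def TracialFunc.modulus : ∀ f : TracialFunc, (Fin f.arity → ℕ) → ℝ → ℝ
  | zero, _, _ => 1
  | one, _, _ => 1
  | add, _, ε => ε / 2
  | mul, D, ε => ε / ((D (0 : Fin 2) : ℝ) + D (1 : Fin 2) + 1)
  | star, _, ε => ε
  | smul c, _, ε => ε / (‖c‖ + 1)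

/-- The continuous language of tracial von Neumann algebras: one sort with the `2`-norm metric,
whose domains of quantification are the operator-norm balls of radius `n ∈ ℕ`. -/
noncomputable def tracialLanguage : MetricLanguage.{0} where
  Srt := Unit
  Dom _ := ℕ
  domPreorder _ := inferInstance
  dom_directed _ D E := ⟨max D E, le_max_left D E, le_max_right D E⟩
  diam n := 2 * n
  Func := TracialFunc
  funcArity := TracialFunc.arity
  funcIn _ _ := ()
  funcOut _ := ()
  funcDom := TracialFunc.radius
  funcMod := TracialFunc.modulus
  funcMod_pos f D ε hε := by
    cases f <;> simp only [TracialFunc.modulus] <;> positivity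
  Rel := TracialRel
  relArity _ := 1
  relIn _ _ := ()
  relBound _ D := ((D (0 : Fin 1) : ℕ) : ℝ)
  relMod _ _ ε := ε
  relMod_pos _ _ _ hε := hε

/-- Interpretation of the function symbols. -/
noncomputable def TracialVNA.interpFunc (M : TracialVNA.{w}) :
    ∀ f : TracialFunc, (Fin f.arity → M.Elem) → M.Elem
  | .zero, _ => 0
  | .one, _ => 1
  | .add, x => x (0 : Fin 2) + x (1 : Fin 2)
  | .mul, x => x (0 : Fin 2) * x (1 : Fin 2)
  | .star, x => Star.star (x (0 : Fin 1))
  | .smul c, x => c • x (0 : Fin 1)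

/-- Interpretation of the predicate symbols. -/
noncomputable def TracialVNA.interpRel (M : TracialVNA.{w}) : TracialRel → (Fin 1 → M.Elem) → ℝ
  | .trRe, x => (M.trace (x 0)).re
  | .trIm, x => (M.trace (x 0)).im

theorem TracialVNA.interpFunc_mem (M : TracialVNA.{w}) (f : TracialFunc) (D : Fin f.arity → ℕ)
    (x : Fin f.arity → M.Elem) (hx : ∀ j, x j ∈ M.opBall (D j)) :
    M.interpFunc f x ∈ M.opBall (f.radius D) := by
  cases f with
  | zero => simp [opBall, interpFunc, TracialFunc.radius, op_zero]
  | one =>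
    simp only [opBall, interpFunc, TracialFunc.radius, op_one, Set.mem_ofPred_eq, Nat.cast_one]
    exact ContinuousLinearMap.norm_id_le
  | add =>
    simp only [opBall, interpFunc, TracialFunc.radius, op_add, Set.mem_ofPred_eq, Nat.cast_add]
    exact (norm_add_le _ _).trans (add_le_add (hx (0 : Fin 2)) (hx (1 : Fin 2)))
  | mul =>
    simp only [opBall, interpFunc, TracialFunc.radius, op_mul, Set.mem_ofPred_eq, Nat.cast_mul]
    exact (norm_mul_le _ _).trans
      (mul_le_mul (hx (0 : Fin 2)) (hx (1 : Fin 2)) (norm_nonneg _) (Nat.cast_nonneg _))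
  | star =>
    simp only [opBall, interpFunc, TracialFunc.radius, op_star, Set.mem_ofPred_eq,
      _root_.norm_star]
    exact hx (0 : Fin 1)
  | smul c =>
    simp only [opBall, interpFunc, TracialFunc.radius, op_smul, Set.mem_ofPred_eq, Nat.cast_mul,
      norm_smul]
    exact mul_le_mul (Nat.le_ceil _) (hx (0 : Fin 1)) (norm_nonneg _) (Nat.cast_nonneg _)

theorem TracialVNA.interpFunc_unif (M : TracialVNA.{w}) (f : TracialFunc) (D : Fin f.arity → ℕ)
    (ε : ℝ) (hε : 0 < ε) (x y : Fin f.arity → M.Elem) (hx : ∀ j, x j ∈ M.opBall (D j))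
    (hy : ∀ j, y j ∈ M.opBall (D j)) (h : ∀ j, dist (x j) (y j) < f.modulus D ε) :
    dist (M.interpFunc f x) (M.interpFunc f y) ≤ ε := by
  cases f with
  | zero => simpa [interpFunc] using hε.le
  | one => simpa [interpFunc] using hε.le
  | add =>
    have h0 := h (0 : Fin 2)
    have h1 := h (1 : Fin 2)
    simp only [interpFunc, TracialFunc.modulus] at h0 h1 ⊢
    exact (dist_add_add_le _ _ _ _).trans (by linarith)
  | mul =>
    have h0 := h (0 : Fin 2)
    have h1 := h (1 : Fin 2)
    have hx0 : ‖(x (0 : Fin 2)).op‖ ≤ D (0 : Fin 2) := hx (0 : Fin 2)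
    have hy1 : ‖(y (1 : Fin 2)).op‖ ≤ D (1 : Fin 2) := hy (1 : Fin 2)
    simp only [interpFunc, TracialFunc.modulus, dist_eq_norm] at h0 h1 ⊢
    have e : x (0 : Fin 2) * x (1 : Fin 2) - y (0 : Fin 2) * y (1 : Fin 2) =
        x (0 : Fin 2) * (x (1 : Fin 2) - y (1 : Fin 2)) +
          (x (0 : Fin 2) - y (0 : Fin 2)) * y (1 : Fin 2) := by noncomm_ring
    rw [e]
    refine (norm_add_le _ _).trans ((add_le_add (M.norm_mul_le_left _ _ _ hx0)
      (M.norm_mul_le_right _ _ _ hy1)).trans ?_)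
    set a : ℝ := ((D (0 : Fin 2) : ℕ) : ℝ)
    set b : ℝ := ((D (1 : Fin 2) : ℕ) : ℝ)
    have ha : 0 ≤ a := Nat.cast_nonneg _
    have hb : 0 ≤ b := Nat.cast_nonneg _
    calc a * ‖x (1 : Fin 2) - y (1 : Fin 2)‖ + b * ‖x (0 : Fin 2) - y (0 : Fin 2)‖
        ≤ a * (ε / (a + b + 1)) + b * (ε / (a + b + 1)) := by gcongr
      _ = (a + b) / (a + b + 1) * ε := by ring
      _ ≤ 1 * ε := by
          gcongr
          exact (div_le_one (by positivity)).2 (by linarith)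
      _ = ε := one_mul ε
  | star =>
    have h0 := h (0 : Fin 1)
    simp only [interpFunc, TracialFunc.modulus, dist_eq_norm] at h0 ⊢
    rw [← star_sub, M.norm_star]
    exact h0.le
  | smul c =>
    have h0 := h (0 : Fin 1)
    simp only [interpFunc, TracialFunc.modulus, dist_eq_norm] at h0 ⊢
    rw [← smul_sub, norm_smul]
    calc ‖c‖ * ‖x (0 : Fin 1) - y (0 : Fin 1)‖ ≤ ‖c‖ * (ε / (‖c‖ + 1)) := by gcongr
      _ = ‖c‖ / (‖c‖ + 1) * ε := by ring
      _ ≤ 1 * ε := by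
          gcongr
          exact (div_le_one (by positivity)).2 (by linarith)
      _ = ε := one_mul ε

theorem TracialVNA.abs_interpRel_le (M : TracialVNA.{w}) (R : TracialRel) (x : Fin 1 → M.Elem) :
    |M.interpRel R x| ≤ ‖x 0‖ := by
  cases R with
  | trRe => exact (Complex.abs_re_le_norm _).trans (M.norm_trace_le _)
  | trIm => exact (Complex.abs_im_le_norm _).trans (M.norm_trace_le _)

theorem TracialVNA.interpRel_sub (M : TracialVNA.{w}) (R : TracialRel) (x y : Fin 1 → M.Elem) :
    M.interpRel R x - M.interpRel R y = M.interpRel R (x - y) := by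
  cases R <;> simp [interpRel]

theorem TracialVNA.interpRel_unif (M : TracialVNA.{w}) (R : TracialRel) (ε : ℝ)
    (x y : Fin 1 → M.Elem) (h : ∀ j, dist (x j) (y j) < ε) :
    |M.interpRel R x - M.interpRel R y| ≤ ε := by
  rw [M.interpRel_sub]
  refine (M.abs_interpRel_le R _).trans ?_
  have h0 := h 0
  rw [dist_eq_norm] at h0
  exact h0.le

theorem TracialVNA.dist_le_of_mem (M : TracialVNA.{w}) (n : ℕ) (x y : M.Elem)
    (hx : x ∈ M.opBall n) (hy : y ∈ M.opBall n) : dist x y ≤ 2 * (n : ℝ) := by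
  rw [dist_eq_norm]
  refine (norm_sub_le x y).trans ?_
  have h1 := M.norm_le x _ hx
  have h2 := M.norm_le y _ hy
  linarith

theorem TracialVNA.opBall_nonempty (M : TracialVNA.{w}) (n : ℕ) : (M.opBall n).Nonempty :=
  ⟨0, by simp [opBall, op_zero]⟩

theorem TracialVNA.opBall_mono (M : TracialVNA.{w}) {m n : ℕ} (h : m ≤ n) :
    M.opBall m ⊆ M.opBall n :=
  fun x (hx : ‖x.op‖ ≤ m) => show ‖x.op‖ ≤ n from hx.trans (Nat.cast_le.2 h)

theorem TracialVNA.exists_mem_opBall (M : TracialVNA.{w}) (x : M.Elem) : ∃ n, x ∈ M.opBall n :=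
  ⟨⌈‖x.op‖⌉₊, Nat.le_ceil ‖x.op‖⟩

/-- A tracial von Neumann algebra as a metric structure. -/
noncomputable def TracialVNA.toStructure (M : TracialVNA.{w}) :
    MetricStructure.{0, w} tracialLanguage where
  carrier _ := M.Elem
  metric _ := inferInstance
  dom n := M.opBall n
  dom_nonempty n := M.opBall_nonempty n
  dom_mono h := M.opBall_mono h
  dom_cover x := M.exists_mem_opBall x
  dom_complete _ := M.isComplete_opBall _
  dom_diam n x hx y hy := M.dist_le_of_mem n x y hx hy
  func := M.interpFunc
  func_mem := M.interpFunc_mem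
  func_unif := M.interpFunc_unif
  rel := M.interpRel
  rel_bound R _ x hx := (M.abs_interpRel_le R x).trans (M.norm_le _ _ (hx (0 : Fin 1)))
  rel_unif R _ ε _ x y _ _ h := M.interpRel_unif R ε x y h

/-- The hyperfinite II₁ factor (unique up to isomorphism): an infinite-dimensional factor with a
faithful normal tracial state that is generated as a von Neumann algebra by an increasing sequence
of finite-dimensional `*`-subalgebras. -/
def TracialVNA.IsHyperfiniteII1Factor (R : TracialVNA.{w}) : Prop :=
  (∀ x ∈ R.alg, x ∈ R.alg.commutant → ∃ c : ℂ, x = c • (1 : R.H →L[ℂ] R.H)) ∧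
  ¬ FiniteDimensional ℂ R.alg.toStarSubalgebra ∧
  ∃ F : ℕ → StarSubalgebra ℂ (R.H →L[ℂ] R.H), Monotone F ∧ (∀ n, FiniteDimensional ℂ (F n)) ∧
    Set.centralizer (Set.centralizer (⋃ n, (F n : Set (R.H →L[ℂ] R.H)))) =
      (R.alg : Set (R.H →L[ℂ] R.H))

/-- `M` embeds into the tracial ultrapower of `R` by a nonprincipal ultrafilter on some index
set. -/
def TracialVNA.IsUltrapowerEmbeddable (R M : TracialVNA.{w}) : Prop :=
  ∃ (I : Type w) (U : Ultrafilter I), (∀ i, U ≠ pure i) ∧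
    Nonempty (M.toStructure.Embedding (MetricStructure.ultraproduct U fun _ => R.toStructure))

/-- The class of tracial von Neumann algebras that embed into ultrapowers of `R`. -/
def TracialVNA.ultrapowerEmbeddableClass (R : TracialVNA.{w}) :
    Set (MetricStructure.{0, w} tracialLanguage) :=
  {X | ∃ M : TracialVNA.{w}, R.IsUltrapowerEmbeddable M ∧ M.toStructure = X}

/-! ## Łoś's theorem -/

/-! Existential closedness yields an embedding into an ultrapower. Let `A` be e.c. in `B` via `i`,
and give every element of `B` a variable. A quantifier-free condition that finitely many elements of
`B` satisfy over `A` has approximate solutions in `A`, and finitely many conditions combine into one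
by adding their errors. Hence there are an ultrafilter `U`, on the set of all choices of values in
`A` for the variables, and an embedding `B → A^U` that sends `i a` to the class of the constant
family `a` (`MetricStructure.Embedding.IsExistentiallyClosed.exists_ultrapower`).

Given `j : A → C`, the amalgam is `C^U`: `B` enters through `A^U → C^U` and `C` enters diagonally.
The two maps agree on `A`. The amalgamation is strong because an element of `C` whose diagonal image
comes from `A^U` is a `U`-limit of points `j (x k)` with all `x k` in one domain of `A`; the image
of that domain is complete, hence closed, so the limit lies in `j(A)`
(`MetricStructure.Embedding.mem_range_of_ultraMap_eq`). For models of a theory, `C^U` is again a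
model by Łoś's theorem.

For the second class, `C ⊆ R^V` gives `C^U ⊆ (R^V)^U ⊆ R^W`, where `W` is the iterated ultrafilter.
It remains to realize the metric ultrapower as a genuine tracial von Neumann algebra. On the
completion `L²` of the bounded families, take the operators `T` that commute with all right
multiplications; the point is that `T` is left multiplication by a family with the same norm bound
`n` (`TracialVNA.Bdd.exists_eq_left`). Since `T` is determined by its value on the vacuum vector
`Ω`, it suffices that `T Ω` lies in the image of the ball of radius `n`, which is convex and
complete. Otherwise the nearest point of the ball would separate it from `T Ω`. This is excluded by
an approximate polar decomposition `y = w k²` with `w` a contraction: `⟪y, T Ω⟫ = ⟪w k, T k⟫` has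
real part at most `n tr(k²)`, which is nearly at most `Re ⟪y, n w⟫`, and `n w` belongs to the ball.
-/

theorem MetricLanguage.Term.exists_dom {L : MetricLanguage.{u}} {Γ : List L.Srt}
    (E : ∀ k : Fin Γ.length, L.Dom (Γ.get k)) {s : L.Srt} (t : L.Term Γ s) :
    ∃ D : L.Dom s, ∀ (M : MetricStructure.{u, w} L) (a : M.Assignment Γ),
      (∀ k, a k ∈ M.dom (E k)) → t.eval M a ∈ M.dom D := by
  induction t with
  | var k => exact ⟨E k, fun M a ha => ha k⟩
  | app f t ih =>
    choose D hD using ih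
    exact ⟨L.funcDom f D, fun M a ha => M.func_mem f D _ fun j => hD j M a ha⟩

theorem MetricStructure.Assignment.cons_mem {L : MetricLanguage.{u}}
    {M : MetricStructure.{u, w} L} {Γ : List L.Srt} {s : L.Srt} {D : L.Dom s}
    {E : ∀ k : Fin Γ.length, L.Dom (Γ.get k)} {x : M.carrier s} {a : M.Assignment Γ}
    (hx : x ∈ M.dom D) (ha : ∀ k, a k ∈ M.dom (E k)) (k : Fin (s :: Γ).length) :
    Assignment.cons x a k ∈
      M.dom (Fin.cons (α := fun i : Fin (Γ.length + 1) => L.Dom ((s :: Γ).get i)) D E k) :=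
  Fin.cases (motive := fun k : Fin (Γ.length + 1) => Assignment.cons x a k ∈
      M.dom (Fin.cons (α := fun i : Fin (Γ.length + 1) => L.Dom ((s :: Γ).get i)) D E k))
    hx ha k

theorem abs_ciInf_le_of_forall {ι : Type w} [Nonempty ι] {f : ι → ℝ} {C : ℝ}
    (h : ∀ i, |f i| ≤ C) : |⨅ i, f i| ≤ C := by
  have hb : BddBelow (Set.range f) := ⟨-C, by rintro _ ⟨i, rfl⟩; exact (abs_le.1 (h i)).1⟩
  obtain ⟨i⟩ := ‹Nonempty ι›
  have : Nonempty ι := ⟨i⟩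
  exact abs_le.2 ⟨le_ciInf fun i => (abs_le.1 (h i)).1, (ciInf_le hb i).trans (abs_le.1 (h i)).2⟩

theorem abs_ciSup_le_of_forall {ι : Type w} [Nonempty ι] {f : ι → ℝ} {C : ℝ}
    (h : ∀ i, |f i| ≤ C) : |⨆ i, f i| ≤ C := by
  have hb : BddAbove (Set.range f) := ⟨C, by rintro _ ⟨i, rfl⟩; exact (abs_le.1 (h i)).2⟩
  obtain ⟨i⟩ := ‹Nonempty ι›
  have : Nonempty ι := ⟨i⟩
  exact abs_le.2 ⟨(abs_le.1 (h i)).1.trans (le_ciSup hb i), ciSup_le fun i => (abs_le.1 (h i)).2⟩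

/-- No boundedness is required, because the infimum of a set of reals is defined as minus the
supremum of its negative, default values included. Suprema are thereby reduced to infima in
`UltraCarrier.tendsto_iSup`. -/
theorem neg_ciInf_neg {ι : Type w} (f : ι → ℝ) : (-⨅ i, -f i) = ⨆ i, f i := by
  have h : -Set.range (fun i => -f i) = Set.range f := Set.ext fun y => by simp
  rw [iInf, Real.sInf_def, neg_neg, h, iSup]

/-- Formulas are bounded on domains, uniformly in the structure. -/
theorem MetricLanguage.Formula.exists_bound {L : MetricLanguage.{u}} {Γ : List L.Srt}
    (φ : L.Formula Γ) : ∀ E : ∀ k : Fin Γ.length, L.Dom (Γ.get k),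
    ∃ C : ℝ, ∀ (M : MetricStructure.{u, w} L) (a : M.Assignment Γ),
      (∀ k, a k ∈ M.dom (E k)) → |φ.eval M a| ≤ C := by
  induction φ with
  | @dist Γ s t t' =>
    intro E
    obtain ⟨D, hD⟩ := t.exists_dom.{u, w} E
    obtain ⟨D', hD'⟩ := t'.exists_dom.{u, w} E
    obtain ⟨F, h, h'⟩ := L.dom_directed s D D'
    refine ⟨L.diam F, fun M a ha => ?_⟩
    rw [MetricLanguage.Formula.eval, abs_of_nonneg dist_nonneg]
    exact M.dom_diam F _ (M.dom_mono h (hD M a ha)) _ (M.dom_mono h' (hD' M a ha))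
  | rel R t =>
    intro E
    choose D hD using fun j => (t j).exists_dom.{u, w} E
    exact ⟨L.relBound R D, fun M a ha => M.rel_bound R D _ fun j => hD j M a ha⟩
  | conn n c φ ih =>
    intro E
    choose C hC using fun k => ih k E
    -- A connective need not be bounded on `ℝⁿ`, but its arguments stay in a compact box that does
    -- not depend on the structure.
    obtain ⟨K, hK⟩ := (isCompact_univ_pi fun k => isCompact_Icc (a := -C k) (b := C k)
      ).exists_bound_of_continuousOn c.continuous.continuousOn
    exact ⟨K, fun M a ha => hK _ fun k _ => abs_le.1 (hC k M a ha)⟩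
  | sup D φ ih =>
    intro E
    obtain ⟨C, hC⟩ := ih (Fin.cons D E)
    refine ⟨C, fun M a ha => ?_⟩
    have := (M.dom_nonempty D).to_subtype
    exact abs_ciSup_le_of_forall fun x => hC M _ (MetricStructure.Assignment.cons_mem x.2 ha)
  | inf D φ ih =>
    intro E
    obtain ⟨C, hC⟩ := ih (Fin.cons D E)
    refine ⟨C, fun M a ha => ?_⟩
    have := (M.dom_nonempty D).to_subtype
    exact abs_ciInf_le_of_forall fun x => hC M _ (MetricStructure.Assignment.cons_mem x.2 ha)

theorem MetricStructure.exists_dom_assignment {L : MetricLanguage.{u}}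
    (M : MetricStructure.{u, w} L) {Γ : List L.Srt} (a : M.Assignment Γ) :
    ∃ E : ∀ k : Fin Γ.length, L.Dom (Γ.get k), ∀ k, a k ∈ M.dom (E k) := by
  choose E hE using fun k => M.dom_cover (a k)
  exact ⟨E, hE⟩

theorem MetricLanguage.Formula.exists_bound_cons {L : MetricLanguage.{u}} {Γ : List L.Srt}
    {s : L.Srt} (D : L.Dom s) (φ : L.Formula (s :: Γ)) (M : MetricStructure.{u, w} L)
    (a : M.Assignment Γ) : ∃ C : ℝ, ∀ x : M.dom D, |φ.eval M (.cons x.1 a)| ≤ C := by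
  obtain ⟨E, hE⟩ := M.exists_dom_assignment a
  obtain ⟨C, hC⟩ := φ.exists_bound.{u, w} (Fin.cons D E)
  exact ⟨C, fun x => hC M _ (MetricStructure.Assignment.cons_mem x.2 hE)⟩

/-- The real infimum of a set unbounded below is the default value 0, so the bound is needed before
any value can be compared with an `inf` formula. -/
theorem MetricLanguage.Formula.bddBelow_range {L : MetricLanguage.{u}} {Γ : List L.Srt}
    {s : L.Srt} (D : L.Dom s) (φ : L.Formula (s :: Γ)) (M : MetricStructure.{u, w} L)
    (a : M.Assignment Γ) :
    BddBelow (Set.range fun x : M.dom D => φ.eval M (.cons x.1 a)) := by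
  obtain ⟨C, hC⟩ := φ.exists_bound_cons D M a
  exact ⟨-C, by rintro _ ⟨x, rfl⟩; exact (abs_le.1 (hC x)).1⟩

section Ultraproduct

variable {L : MetricLanguage.{u}} {I : Type w'} (U : Ultrafilter I)
  {N : I → MetricStructure.{u, w} L}

theorem MetricStructure.ultraproduct_func (f : L.Func)
    (x : ∀ j, BoundedFamily N (L.funcIn f j)) :
    (ultraproduct U N).func f (fun j => UltraCarrier.mk U (x j)) =
      UltraCarrier.mk U (BoundedFamily.func f x) :=
  UltraCarrier.mk_func_congr U f _ _ fun _ => UltraCarrier.mk_rep _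

theorem MetricStructure.ultraproduct_rel (R : L.Rel) (x : ∀ j, BoundedFamily N (L.relIn R j)) :
    (ultraproduct U N).rel R (fun j => UltraCarrier.mk U (x j)) =
      ultraLim U fun i => (N i).rel R fun j => (x j).1 i :=
  UltraCarrier.rel_congr U R _ _ fun _ => UltraCarrier.mk_rep _

theorem MetricStructure.mk_mem_dom {s : L.Srt} {D : L.Dom s} {x : BoundedFamily N s}
    (hx : ∀ i, x.1 i ∈ (N i).dom D) :
    UltraCarrier.mk U x ∈ (ultraproduct U N).dom D := ⟨x, hx, rfl⟩

/-- Evaluation of a term on a family of assignments. -/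
def MetricLanguage.Term.evalFamily {Γ : List L.Srt} (a : ∀ k, BoundedFamily N (Γ.get k)) :
    ∀ {s : L.Srt}, L.Term Γ s → BoundedFamily N s
  | _, .var k => a k
  | _, .app f t => BoundedFamily.func f fun j => (t j).evalFamily a

theorem MetricLanguage.Term.evalFamily_apply {Γ : List L.Srt}
    (a : ∀ k, BoundedFamily N (Γ.get k)) {s : L.Srt} (t : L.Term Γ s) (i : I) :
    (t.evalFamily a).1 i = t.eval (N i) fun k => (a k).1 i := by
  induction t with
  | var k => rfl
  | app f t ih => exact congrArg ((N i).func f) (funext ih)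

theorem MetricLanguage.Term.eval_ultraproduct {Γ : List L.Srt}
    (a : ∀ k, BoundedFamily N (Γ.get k)) {s : L.Srt} (t : L.Term Γ s) :
    t.eval (.ultraproduct U N) (fun k => UltraCarrier.mk U (a k)) =
      UltraCarrier.mk U (t.evalFamily a) := by
  induction t with
  | var k => rfl
  | app f t ih =>
    refine Eq.trans (congrArg ((MetricStructure.ultraproduct U N).func f) (funext ih)) ?_
    exact MetricStructure.ultraproduct_func U f _

theorem BoundedFamily.exists_dom {Γ : List L.Srt} (a : ∀ k, BoundedFamily N (Γ.get k)) :
    ∃ E : ∀ k : Fin Γ.length, L.Dom (Γ.get k), ∀ k i, (a k).1 i ∈ (N i).dom (E k) := by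
  choose E hE using fun k => (a k).2
  exact ⟨E, hE⟩

/-- The family of assignments obtained by adding a first variable. -/
def BoundedFamily.cons {Γ : List L.Srt} {s : L.Srt} (x : BoundedFamily N s)
    (a : ∀ k, BoundedFamily N (Γ.get k)) : ∀ k, BoundedFamily N ((s :: Γ).get k) :=
  Fin.cons (α := fun i : Fin (Γ.length + 1) => BoundedFamily N ((s :: Γ).get i)) x a

theorem BoundedFamily.cons_apply {Γ : List L.Srt} {s : L.Srt} (x : BoundedFamily N s)
    (a : ∀ k, BoundedFamily N (Γ.get k)) (i : I) :
    (fun k => (BoundedFamily.cons x a k).1 i) =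
      MetricStructure.Assignment.cons (x.1 i) fun k => (a k).1 i :=
  funext fun k => Fin.cases (motive := fun k : Fin (Γ.length + 1) =>
    (BoundedFamily.cons x a k).1 i =
      MetricStructure.Assignment.cons (x.1 i) (fun k => (a k).1 i) k) rfl (fun _ => rfl) k

theorem BoundedFamily.cons_mk {Γ : List L.Srt} {s : L.Srt} (x : BoundedFamily N s)
    (a : ∀ k, BoundedFamily N (Γ.get k)) :
    (fun k => UltraCarrier.mk U (BoundedFamily.cons x a k)) =
      MetricStructure.Assignment.cons (M := .ultraproduct U N) (UltraCarrier.mk U x)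
        fun k => UltraCarrier.mk U (a k) :=
  funext fun k => Fin.cases (motive := fun k : Fin (Γ.length + 1) =>
    UltraCarrier.mk U (BoundedFamily.cons x a k) =
      MetricStructure.Assignment.cons (M := .ultraproduct U N) (UltraCarrier.mk U x)
        (fun k => UltraCarrier.mk U (a k)) k) rfl (fun _ => rfl) k

/-- Limits of infima over the domains of the factors. -/
theorem UltraCarrier.tendsto_iInf {s : L.Srt} (D : L.Dom s)
    (F : ∀ i, (N i).carrier s → ℝ) (G : UltraCarrier U N s → ℝ) (C : ℝ)
    (hF : ∀ i, ∀ x ∈ (N i).dom D, |F i x| ≤ C)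
    (hFG : ∀ x : BoundedFamily N s, (∀ i, x.1 i ∈ (N i).dom D) →
      Tendsto (fun i => F i (x.1 i)) U (𝓝 (G (UltraCarrier.mk U x)))) :
    Tendsto (fun i => ⨅ x : (N i).dom D, F i x.1) U
      (𝓝 (⨅ q : (MetricStructure.ultraproduct U N).dom D, G q.1)) := by
  have := fun i => ((N i).dom_nonempty D).to_subtype
  have := ((MetricStructure.ultraproduct U N).dom_nonempty D).to_subtype
  have hbF : ∀ i, BddBelow (Set.range fun x : (N i).dom D => F i x.1) := fun i =>
    ⟨-C, by rintro _ ⟨x, rfl⟩; exact (abs_le.1 (hF i x.1 x.2)).1⟩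
  have hG : ∀ q : (MetricStructure.ultraproduct U N).dom D, |G q.1| ≤ C := by
    rintro ⟨_, x, hx, rfl⟩
    exact le_of_tendsto' (hFG x hx).abs fun i => hF i _ (hx i)
  have hbG : BddBelow (Set.range fun q : (MetricStructure.ultraproduct U N).dom D => G q.1) :=
    ⟨-C, by rintro _ ⟨x, rfl⟩; exact (abs_le.1 (hG x)).1⟩
  have hl := tendsto_ultraLim U fun i => abs_ciInf_le_of_forall fun x : (N i).dom D => hF i x.1 x.2
  -- Compactness already provides a limit; only its value has to be identified.
  convert hl using 2
  refine le_antisymm (le_of_forall_pos_le_add fun ε hε => ?_) (le_ciInf ?_)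
  -- Near-minimizers chosen in every factor lie in the common domain `D`, so they form an element of
  -- the domain of the ultraproduct.
  · choose x hx using fun i => exists_lt_of_ciInf_lt
      (lt_add_of_pos_right (⨅ x : (N i).dom D, F i x.1) hε)
    let y : BoundedFamily N s := ⟨fun i => (x i).1, D, fun i => (x i).2⟩
    have hy : ∀ i, y.1 i ∈ (N i).dom D := fun i => (x i).2
    refine (ciInf_le hbG ⟨UltraCarrier.mk U y, y, hy, rfl⟩).trans ?_
    exact le_of_tendsto_of_tendsto' (hFG y hy) (hl.add_const ε) fun i => (hx i).le
  · rintro ⟨_, x, hx, rfl⟩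
    exact le_of_tendsto_of_tendsto' hl (hFG x hx) fun i => ciInf_le (hbF i) ⟨x.1 i, hx i⟩

theorem UltraCarrier.tendsto_iSup {s : L.Srt} (D : L.Dom s)
    (F : ∀ i, (N i).carrier s → ℝ) (G : UltraCarrier U N s → ℝ) (C : ℝ)
    (hF : ∀ i, ∀ x ∈ (N i).dom D, |F i x| ≤ C)
    (hFG : ∀ x : BoundedFamily N s, (∀ i, x.1 i ∈ (N i).dom D) →
      Tendsto (fun i => F i (x.1 i)) U (𝓝 (G (UltraCarrier.mk U x)))) :
    Tendsto (fun i => ⨆ x : (N i).dom D, F i x.1) U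
      (𝓝 (⨆ q : (MetricStructure.ultraproduct U N).dom D, G q.1)) := by
  have h := (UltraCarrier.tendsto_iInf U D (fun i x => -F i x) (fun q => -G q) C
    (fun i x hx => by rw [abs_neg]; exact hF i x hx) fun x hx => (hFG x hx).neg).neg
  simpa only [neg_ciInf_neg] using h

/-- Łoś's theorem. -/
theorem MetricLanguage.Formula.tendsto_eval {Γ : List L.Srt} (φ : L.Formula Γ) :
    ∀ a : ∀ k, BoundedFamily N (Γ.get k),
    Tendsto (fun i => φ.eval (N i) fun k => (a k).1 i) U
      (𝓝 (φ.eval (.ultraproduct U N) fun k => UltraCarrier.mk U (a k))) := by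
  induction φ with
  | dist t t' =>
    intro a
    simp only [MetricLanguage.Formula.eval, MetricLanguage.Term.eval_ultraproduct,
      ← MetricLanguage.Term.evalFamily_apply]
    exact UltraCarrier.tendsto_dist U _ _
  | rel R t =>
    intro a
    simp only [MetricLanguage.Formula.eval, MetricLanguage.Term.eval_ultraproduct,
      ← MetricLanguage.Term.evalFamily_apply, MetricStructure.ultraproduct_rel]
    exact BoundedFamily.tendsto_rel U R _
  | conn n c φ ih =>
    intro a
    exact (c.continuous.tendsto _).comp (tendsto_pi_nhds.2 fun k => ih k a)
  | @sup Γ s D φ ih =>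
    intro a
    obtain ⟨E, hE⟩ := BoundedFamily.exists_dom a
    obtain ⟨C, hC⟩ := φ.exists_bound.{u, w} (Fin.cons D E)
    refine UltraCarrier.tendsto_iSup U D
      (fun i x => φ.eval (N i) (.cons x fun k => (a k).1 i))
      (fun q => φ.eval (.ultraproduct U N)
        (MetricStructure.Assignment.cons (M := .ultraproduct U N) q
          fun k => UltraCarrier.mk U (a k))) C
      (fun i x hx => hC _ _ (MetricStructure.Assignment.cons_mem hx fun k => hE k i))
      fun x hx => ?_
    have := ih (BoundedFamily.cons x a)
    simpa only [BoundedFamily.cons_apply, BoundedFamily.cons_mk] using this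
  | @inf Γ s D φ ih =>
    intro a
    obtain ⟨E, hE⟩ := BoundedFamily.exists_dom a
    obtain ⟨C, hC⟩ := φ.exists_bound.{u, w} (Fin.cons D E)
    refine UltraCarrier.tendsto_iInf U D
      (fun i x => φ.eval (N i) (.cons x fun k => (a k).1 i))
      (fun q => φ.eval (.ultraproduct U N)
        (MetricStructure.Assignment.cons (M := .ultraproduct U N) q
          fun k => UltraCarrier.mk U (a k))) C
      (fun i x hx => hC _ _ (MetricStructure.Assignment.cons_mem hx fun k => hE k i))
      fun x hx => ?_
    have := ih (BoundedFamily.cons x a)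
    simpa only [BoundedFamily.cons_apply, BoundedFamily.cons_mk] using this

/-- The value of `σ` in the ultraproduct is the limit of a constant zero family. The sentences of
`T` may carry any quantifiers, so Łoś's theorem is needed for all formulas. -/
theorem MetricStructure.ultraproduct_mem_Mod {T : Set L.Sentence} (h : ∀ i, N i ∈ Mod T) :
    ultraproduct U N ∈ Mod T := fun σ hσ => by
  have h1 := MetricLanguage.Formula.tendsto_eval U (N := N) σ fun k => k.elim0
  have h2 := h1.congr fun i =>
    (congrArg (σ.eval (N i)) (funext fun k => k.elim0)).trans (h i σ hσ)
  exact (congrArg (σ.eval _) (funext fun k => k.elim0)).trans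
    (tendsto_nhds_unique h2 tendsto_const_nhds)

end Ultraproduct

/-! ## Finite systems of conditions -/

def MetricLanguage.Term.lift {L : MetricLanguage.{u}} {Γ : List L.Srt} (s' : L.Srt) :
    ∀ {s : L.Srt}, L.Term Γ s → L.Term (s' :: Γ) s
  | _, .var k => .var (Γ := s' :: Γ) k.succ
  | _, .app f t => .app f fun j => (t j).lift s'

theorem MetricLanguage.Term.eval_lift {L : MetricLanguage.{u}} {M : MetricStructure.{u, w} L}
    {Γ : List L.Srt} {s' : L.Srt} (x : M.carrier s') (a : M.Assignment Γ) {s : L.Srt}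
    (t : L.Term Γ s) : (t.lift s').eval M (.cons x a) = t.eval M a := by
  induction t with
  | var k => rfl
  | app f t ih => exact congrArg (M.func f) (funext ih)

section Extend

variable {L : MetricLanguage.{u}} {V : Type w'} (σ : V → L.Srt)

/-- The assignment giving the variables in `l` their values under `x`, and `a` for the rest. -/
def MetricStructure.Assignment.extend {M : MetricStructure.{u, w} L}
    (x : ∀ v, M.carrier (σ v)) {Δ : List L.Srt} (a : M.Assignment Δ) :
    ∀ l : List V, M.Assignment (l.map σ ++ Δ)
  | [] => a
  | v :: l => MetricStructure.Assignment.cons (x v) (extend x a l)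

theorem MetricStructure.Assignment.extend_congr {M : MetricStructure.{u, w} L}
    {x y : ∀ v, M.carrier (σ v)} {Δ : List L.Srt} (a : M.Assignment Δ) (l : List V)
    (h : ∀ v ∈ l, x v = y v) : extend σ x a l = extend σ y a l := by
  induction l with
  | nil => rfl
  | cons v l ih =>
    rw [extend, extend, ih fun v hv => h v (List.mem_cons_of_mem _ hv), h v List.mem_cons_self]

theorem MetricStructure.Embedding.comp_cons {M : MetricStructure.{u, w} L}
    {N : MetricStructure.{u, w} L} (i : M.Embedding N) {Γ : List L.Srt} {s : L.Srt}
    (x : M.carrier s) (a : M.Assignment Γ) :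
    (fun k => i.toFun _ (Assignment.cons x a k)) =
      Assignment.cons (i.toFun _ x) fun k => i.toFun _ (a k) :=
  funext fun k => Fin.cases (motive := fun k : Fin (Γ.length + 1) =>
    i.toFun _ (Assignment.cons x a k) =
      Assignment.cons (M := N) (i.toFun _ x) (fun k => i.toFun _ (a k)) k) rfl (fun _ => rfl) k

theorem MetricStructure.Embedding.comp_extend {M : MetricStructure.{u, w} L}
    {N : MetricStructure.{u, w} L} (i : M.Embedding N) (x : ∀ v, M.carrier (σ v))
    {Δ : List L.Srt} (a : M.Assignment Δ) (l : List V) :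
    (fun k => i.toFun _ (Assignment.extend σ x a l k)) =
      Assignment.extend σ (fun v => i.toFun _ (x v)) (fun k => i.toFun _ (a k)) l := by
  induction l with
  | nil => rfl
  | cons v l ih =>
    exact (i.comp_cons (x v) (Assignment.extend σ x a l)).trans
      (congrArg (Assignment.cons (i.toFun _ (x v))) ih)

/-- The order of quantifiers matters: a single term works for all structures, so it can be evaluated
in `A` and in `B` alike. -/
theorem MetricLanguage.Term.exists_eval_extend {Δ : List L.Srt} (l : List V) {s : L.Srt}
    (t : L.Term Δ s) : ∃ t' : L.Term (l.map σ ++ Δ) s,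
      ∀ (M : MetricStructure.{u, w} L) (x : ∀ v, M.carrier (σ v)) (a : M.Assignment Δ),
        t'.eval M (.extend σ x a l) = t.eval M a := by
  induction l with
  | nil => exact ⟨t, fun M x a => rfl⟩
  | cons v l ih =>
    obtain ⟨t', h⟩ := ih
    exact ⟨t'.lift (σ v), fun M x a => (t'.eval_lift _ _).trans (h M x a)⟩

theorem MetricLanguage.Term.exists_eval_extend_of_mem (Δ : List L.Srt) {l : List V} {v : V}
    (hv : v ∈ l) : ∃ t : L.Term (l.map σ ++ Δ) (σ v),
      ∀ (M : MetricStructure.{u, w} L) (x : ∀ v, M.carrier (σ v)) (a : M.Assignment Δ),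
        t.eval M (.extend σ x a l) = x v := by
  induction l with
  | nil => simp at hv
  | cons v' l ih =>
    rcases List.mem_cons.1 hv with rfl | hv
    · exact ⟨.var (Γ := σ v :: (l.map σ ++ Δ)) (0 : Fin (_ + 1)), fun M x a => rfl⟩
    · obtain ⟨t, h⟩ := ih hv
      exact ⟨t.lift (σ v'), fun M x a => (t.eval_lift _ _).trans (h M x a)⟩

/-- The infimum over the variables in `l`, each ranging over its domain. -/
def MetricLanguage.Formula.infs (D : ∀ v, L.Dom (σ v)) {Δ : List L.Srt} :
    ∀ l : List V, L.Formula (l.map σ ++ Δ) → L.Formula Δ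
  | [], φ => φ
  | v :: l, φ => infs D l (.inf (D v) φ)

theorem MetricLanguage.Formula.IsExistential.infs (D : ∀ v, L.Dom (σ v)) {Δ : List L.Srt}
    (l : List V) {φ : L.Formula (l.map σ ++ Δ)} (h : φ.IsExistential) :
    (Formula.infs σ D l φ).IsExistential := by
  induction l with
  | nil => exact h
  | cons v l ih => exact ih (.inf (D v) h)

/-- Applied in `B` to the tautological assignment, where each variable takes the element it names.
-/
theorem MetricLanguage.Formula.eval_infs_le (D : ∀ v, L.Dom (σ v)) {Δ : List L.Srt}
    (l : List V) (φ : L.Formula (l.map σ ++ Δ)) (M : MetricStructure.{u, w} L)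
    (a : M.Assignment Δ) (x : ∀ v, M.carrier (σ v)) (hx : ∀ v, x v ∈ M.dom (D v)) :
    (Formula.infs σ D l φ).eval M a ≤ φ.eval M (.extend σ x a l) := by
  induction l with
  | nil => exact le_rfl
  | cons v l ih =>
    exact (ih (.inf (D v) φ)).trans
      (ciInf_le (bddBelow_range (D v) φ M (.extend σ x a l)) ⟨x v, hx v⟩)

/-- The head of `l` is the innermost quantifier, so its value is chosen after those of the tail,
each taking half of the error still available. Without repetitions in `l`, redefining `x` at the
head leaves the tail unchanged. -/
theorem MetricLanguage.Formula.exists_eval_lt_infs (D : ∀ v, L.Dom (σ v)) {Δ : List L.Srt}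
    (l : List V) (hl : l.Nodup) (φ : L.Formula (l.map σ ++ Δ)) (M : MetricStructure.{u, w} L)
    (a : M.Assignment Δ) {ε : ℝ} (hε : 0 < ε) :
    ∃ x : ∀ v, M.carrier (σ v), (∀ v, x v ∈ M.dom (D v)) ∧
      φ.eval M (.extend σ x a l) < (Formula.infs σ D l φ).eval M a + ε := by
  classical
  induction l generalizing ε with
  | nil =>
    -- Variables outside `l` also receive values in their domains, so that the result is a total
    -- choice.
    choose x hx using fun v => M.dom_nonempty (D v)
    exact ⟨x, hx, lt_add_of_pos_right _ hε⟩
  | cons v l ih =>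
    rw [List.nodup_cons] at hl
    obtain ⟨x, hx, hlt⟩ := ih hl.2 (.inf (D v) φ) (half_pos hε)
    have := (M.dom_nonempty (D v)).to_subtype
    obtain ⟨c, hc⟩ := exists_lt_of_ciInf_lt (lt_add_of_pos_right
      (⨅ c : M.dom (D v), φ.eval M (.cons c.1 (.extend σ x a l))) (half_pos hε))
    refine ⟨Function.update x v c.1, fun v' => ?_, ?_⟩
    · rcases eq_or_ne v' v with rfl | h
      · rw [Function.update_self]; exact c.2
      · rw [Function.update_of_ne h]; exact hx v'
    · rw [MetricStructure.Assignment.extend, Function.update_self,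
        MetricStructure.Assignment.extend_congr σ (y := x) a l fun v' hv' =>
          Function.update_of_ne (ne_of_mem_of_not_mem hv' hl.1) _ _]
      have h1 : (Formula.inf (D v) φ).eval M (.extend σ x a l) =
        ⨅ c : M.dom (D v), φ.eval M (.cons c.1 (.extend σ x a l)) := rfl
      rw [h1] at hlt
      refine hc.trans ?_
      rw [Formula.infs]
      linarith

end Extend

/-! ## Existentially closed embeddings and ultrapowers -/

section Witness

variable {L : MetricLanguage.{u}} {A B : MetricStructure.{u, w} L}

/-- Variables of sort `s`, one for every element of `B` and every domain containing it. -/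
abbrev MetricStructure.SVar (B : MetricStructure.{u, w} L) (s : L.Srt) : Type (max u w) :=
  {p : B.carrier s × L.Dom s // p.1 ∈ B.dom p.2}

abbrev MetricStructure.Var (B : MetricStructure.{u, w} L) : Type (max u w) := Σ s, B.SVar s

abbrev MetricStructure.Param (A : MetricStructure.{u, w} L) : Type (max u w) := Σ s, A.carrier s

/-- The assignment of the parameters in `l` to themselves. -/
def MetricStructure.paramAssignment (A : MetricStructure.{u, w} L) (l : List A.Param) :
    A.Assignment (l.map Sigma.fst ++ []) :=
  .extend (Δ := []) Sigma.fst (fun p => p.2) (fun k : Fin 0 => k.elim0) l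

def MetricStructure.Embedding.paramAssignment (i : A.Embedding B) (l : List A.Param) :
    B.Assignment (l.map Sigma.fst ++ []) :=
  fun k => i.toFun _ (A.paramAssignment l k)

/-- The context made of the variables in `c.1` and the parameters in `c.2`. -/
noncomputable abbrev MetricStructure.context (A B : MetricStructure.{u, w} L)
    (c : Finset B.Var × Finset A.Param) : List L.Srt :=
  c.1.toList.map Sigma.fst ++ (c.2.toList.map Sigma.fst ++ [])

/-- The function `F` of the variables is given by a term, whose value at `B` is `b`. -/
def MetricStructure.Embedding.IsTermValue (i : A.Embedding B) {s : L.Srt}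
    (F : (∀ v : B.Var, A.carrier v.1) → A.carrier s) (b : B.carrier s) : Prop :=
  ∀ᶠ c in atTop, ∃ t : L.Term (A.context B c) s,
    (∀ x, t.eval A (.extend Sigma.fst x (A.paramAssignment c.2.toList) c.1.toList) = F x) ∧
    t.eval B (.extend Sigma.fst (fun v => v.2.1.1) (i.paramAssignment c.2.toList) c.1.toList) = b

/-- The function `F` of the variables is given by a quantifier-free formula, whose value at `B`
is `r`. -/
def MetricStructure.Embedding.IsQFValue (i : A.Embedding B)
    (F : (∀ v : B.Var, A.carrier v.1) → ℝ) (r : ℝ) : Prop :=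
  ∀ᶠ c in atTop, ∃ φ : L.Formula (A.context B c), φ.IsQF ∧
    (∀ x, φ.eval A (.extend Sigma.fst x (A.paramAssignment c.2.toList) c.1.toList) = F x) ∧
    φ.eval B (.extend Sigma.fst (fun v => v.2.1.1) (i.paramAssignment c.2.toList) c.1.toList) = r

theorem MetricStructure.Embedding.isTermValue_var (i : A.Embedding B) {s : L.Srt}
    (p : B.SVar s) : i.IsTermValue (fun x => x ⟨s, p⟩) p.1.1 := by
  filter_upwards [eventually_ge_atTop (({⟨s, p⟩}, ∅) : Finset B.Var × Finset A.Param)] with c hc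
  have hv : (⟨s, p⟩ : B.Var) ∈ c.1.toList := Finset.mem_toList.2 (hc.1 (Finset.mem_singleton_self _))
  obtain ⟨t, ht⟩ := MetricLanguage.Term.exists_eval_extend_of_mem.{u, w} Sigma.fst
    (c.2.toList.map Sigma.fst ++ []) hv
  exact ⟨t, fun x => ht A x _, ht B _ _⟩

theorem MetricStructure.Embedding.isTermValue_param (i : A.Embedding B) {s : L.Srt}
    (a : A.carrier s) : i.IsTermValue (fun _ => a) (i.toFun s a) := by
  filter_upwards [eventually_ge_atTop ((∅, {⟨s, a⟩}) : Finset B.Var × Finset A.Param)] with c hc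
  have hv : (⟨s, a⟩ : A.Param) ∈ c.2.toList :=
    Finset.mem_toList.2 (hc.2 (Finset.mem_singleton_self _))
  obtain ⟨t, ht⟩ := MetricLanguage.Term.exists_eval_extend_of_mem.{u, w} Sigma.fst [] hv
  obtain ⟨t', ht'⟩ := t.exists_eval_extend.{u, w} (V := B.Var) Sigma.fst c.1.toList
  refine ⟨t', fun x => (ht' A x _).trans (ht A _ _), (ht' B _ _).trans ?_⟩
  exact (congrArg (t.eval B) (i.comp_extend _ _ _ _)).trans (ht B _ _)

/-- Asking for a term in all sufficiently large finite contexts makes the property stable under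
finite intersections: the arguments acquire a common context without any renaming of variables. -/
theorem MetricStructure.Embedding.IsTermValue.func {i : A.Embedding B} (f : L.Func)
    {F : ∀ j, (∀ v : B.Var, A.carrier v.1) → A.carrier (L.funcIn f j)}
    {b : ∀ j, B.carrier (L.funcIn f j)} (h : ∀ j, i.IsTermValue (F j) (b j)) :
    i.IsTermValue (fun x => A.func f fun j => F j x) (B.func f b) := by
  filter_upwards [eventually_all.2 h] with c hc
  choose t ht ht' using hc
  exact ⟨.app f t, fun x => congrArg (A.func f) (funext fun j => ht j x),
    congrArg (B.func f) (funext ht')⟩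

theorem MetricStructure.Embedding.IsTermValue.rel {i : A.Embedding B} (R : L.Rel)
    {F : ∀ j, (∀ v : B.Var, A.carrier v.1) → A.carrier (L.relIn R j)}
    {b : ∀ j, B.carrier (L.relIn R j)} (h : ∀ j, i.IsTermValue (F j) (b j)) :
    i.IsQFValue (fun x => A.rel R fun j => F j x) (B.rel R b) := by
  filter_upwards [eventually_all.2 h] with c hc
  choose t ht ht' using hc
  exact ⟨.rel R t, .rel R t, fun x => congrArg (A.rel R) (funext fun j => ht j x),
    congrArg (B.rel R) (funext ht')⟩

theorem MetricStructure.Embedding.IsTermValue.dist {i : A.Embedding B} {s : L.Srt}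
    {F G : (∀ v : B.Var, A.carrier v.1) → A.carrier s} {b b' : B.carrier s}
    (h : i.IsTermValue F b) (h' : i.IsTermValue G b') :
    i.IsQFValue (fun x => Dist.dist (F x) (G x)) (Dist.dist b b') := by
  filter_upwards [h, h'] with c ⟨t, ht, hb⟩ ⟨t', ht', hb'⟩
  exact ⟨.dist t t', .dist t t', fun x => congrArg₂ Dist.dist (ht x) (ht' x),
    congrArg₂ Dist.dist hb hb'⟩

theorem MetricStructure.Embedding.IsQFValue.conn {i : A.Embedding B} {n : ℕ}
    (g : C(Fin n → ℝ, ℝ)) {F : Fin n → (∀ v : B.Var, A.carrier v.1) → ℝ} {r : Fin n → ℝ}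
    (h : ∀ k, i.IsQFValue (F k) (r k)) : i.IsQFValue (fun x => g fun k => F k x) (g r) := by
  filter_upwards [eventually_all.2 h] with c hc
  choose φ hφ ht ht' using hc
  exact ⟨.conn n g φ, .conn n g φ hφ, fun x => congrArg g (funext fun j => ht j x),
    congrArg g (funext ht')⟩

/-- Choices of values in `A` for all variables. -/
abbrev MetricStructure.Choice (A B : MetricStructure.{u, w} L) : Type (max u w) :=
  {x : ∀ v : B.Var, A.carrier v.1 // ∀ v, x v ∈ A.dom v.2.1.2}

/-- The only use of existential closedness. The elements of `B` themselves give the formula the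
value `r`, so its infimum in `B`, hence in `A`, is at most `r`. The one-sided bound suffices because
it will be applied to a sum of absolute values. -/
theorem MetricStructure.Embedding.IsQFValue.exists_lt {i : A.Embedding B}
    (hi : i.IsExistentiallyClosed) {F : (∀ v : B.Var, A.carrier v.1) → ℝ} {r : ℝ}
    (h : i.IsQFValue F r) {ε : ℝ} (hε : 0 < ε) : ∃ x : A.Choice B, F x.1 < r + ε := by
  classical
  obtain ⟨c, φ, hφ, hF, hr⟩ := h.exists
  obtain ⟨x, hx, hlt⟩ := MetricLanguage.Formula.exists_eval_lt_infs Sigma.fst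
    (fun v : B.Var => v.2.1.2) c.1.toList c.1.nodup_toList φ A (A.paramAssignment c.2.toList) hε
  refine ⟨⟨x, hx⟩, ?_⟩
  -- The infimum computed in `A` becomes the infimum computed in `B`.
  rw [hF, hi _ _ (.infs _ _ _ (.qf hφ))] at hlt
  have hle := MetricLanguage.Formula.eval_infs_le Sigma.fst
    (fun v : B.Var => v.2.1.2) c.1.toList φ B (i.paramAssignment c.2.toList)
    (fun v => v.2.1.1) fun v => v.2.2
  rw [hr] at hle
  exact hlt.trans_le (add_le_add_left hle ε)

/-- A compactness argument in the product `ℝ^K`, indexed by all quantifier-free conditions. A basic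
neighbourhood of the tuple of prescribed values involves finitely many conditions, and these are met
up to `ε` by making the sum of their errors small. Hence the filter pulled back to the choices is
proper, and any ultrafilter below it will do. -/
theorem MetricStructure.Embedding.exists_ultrafilter (i : A.Embedding B)
    (hi : i.IsExistentiallyClosed) : ∃ U : Ultrafilter (A.Choice B),
      ∀ (F : (∀ v : B.Var, A.carrier v.1) → ℝ) (r : ℝ), i.IsQFValue F r →
        Tendsto (fun x : A.Choice B => F x.1) U (𝓝 r) := by
  let K := {p : ((∀ v : B.Var, A.carrier v.1) → ℝ) × ℝ // i.IsQFValue p.1 p.2}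
  let Φ : A.Choice B → K → ℝ := fun x k => k.1.1 x.1
  have : (comap Φ (𝓝 fun k => k.1.2)).NeBot := by
    refine comap_neBot_iff.2 fun t ht => ?_
    rw [nhds_pi, mem_pi] at ht
    obtain ⟨J, hJ, S, hS, hsub⟩ := ht
    have h1 : ∀ᶠ ε in 𝓝[>] (0 : ℝ), ∀ k ∈ J, Metric.ball (k.1.2) ε ⊆ S k := by
      refine (eventually_all_finite hJ).2 fun k _ => ?_
      obtain ⟨δ, hδ, h⟩ := Metric.mem_nhds_iff.1 (hS k)
      filter_upwards [Ioo_mem_nhdsGT hδ] with ε hε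
      exact (Metric.ball_subset_ball hε.2.le).trans h
    obtain ⟨ε, hball, hε⟩ := (h1.and self_mem_nhdsWithin).exists
    have hfin := hJ.to_subtype
    obtain ⟨n, ⟨e⟩⟩ := Finite.exists_equiv_fin J
    -- The total error. It is a connective, and its value at `B` is 0.
    let g : C(Fin n → ℝ, ℝ) :=
      ⟨fun y => ∑ m, |y m - (e.symm m).1.1.2|, by fun_prop⟩
    obtain ⟨x, hx⟩ := (MetricStructure.Embedding.IsQFValue.conn g
      fun m => (e.symm m).1.2).exists_lt hi hε
    refine ⟨x, hsub fun k hk => hball k hk ?_⟩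
    have hx' : ∑ m, |(e.symm m).1.1.1 x.1 - (e.symm m).1.1.2| < ε := by
      simpa [g] using hx
    rw [Metric.mem_ball, Real.dist_eq]
    refine lt_of_le_of_lt ?_ hx'
    have := Finset.single_le_sum (f := fun m => |(e.symm m).1.1.1 x.1 - (e.symm m).1.1.2|)
      (fun m _ => abs_nonneg _) (Finset.mem_univ (e ⟨k, hk⟩))
    simpa using this
  refine ⟨Ultrafilter.of (comap Φ (𝓝 fun k => k.1.2)), fun F r h => ?_⟩
  have h1 : Tendsto Φ (Ultrafilter.of (comap Φ (𝓝 fun k => k.1.2)))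
    (𝓝 fun k => k.1.2) := tendsto_comap.mono_left (Ultrafilter.of_le _)
  exact (tendsto_pi_nhds.1 h1) ⟨(F, r), h⟩

/-- Constant families. -/
def BoundedFamily.const (I : Type w') (M : MetricStructure.{u, w} L) {s : L.Srt}
    (x : M.carrier s) : BoundedFamily (fun _ : I => M) s :=
  ⟨fun _ => x, (M.dom_cover x).imp fun _ h _ => h⟩

/-- The values of a variable, as a family. -/
def MetricStructure.SVar.family {s : L.Srt} (p : B.SVar s) :
    BoundedFamily (fun _ : A.Choice B => A) s :=
  ⟨fun x => x.1 ⟨s, p⟩, p.1.2, fun x => x.2 ⟨s, p⟩⟩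

/-- If `A` is existentially closed in `B` then `B` embeds over `A` into an ultrapower of `A`. -/
theorem MetricStructure.Embedding.IsExistentiallyClosed.exists_ultrapower {i : A.Embedding B}
    (hi : i.IsExistentiallyClosed) : ∃ (I : Type (max u w)) (U : Ultrafilter I)
      (h : B.Embedding (ultraproduct U fun _ => A)),
      ∀ (s : L.Srt) (a : A.carrier s),
        h.toFun s (i.toFun s a) = UltraCarrier.mk U (BoundedFamily.const I A a) := by
  obtain ⟨U, hU⟩ := i.exists_ultrafilter hi
  have hdist : ∀ {s : L.Srt} (p q : B.SVar s),
      dist (UltraCarrier.mk U p.family) (UltraCarrier.mk U (q.family (A := A))) =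
        dist p.1.1 q.1.1 := fun p q =>
    tendsto_nhds_unique (UltraCarrier.tendsto_dist U _ _)
      (hU _ _ ((i.isTermValue_var p).dist (i.isTermValue_var q)))
  have hcongr : ∀ {s : L.Srt} (p q : B.SVar s), p.1.1 = q.1.1 →
      UltraCarrier.mk U p.family = UltraCarrier.mk U (q.family (A := A)) := fun p q h =>
    dist_le_zero.1 (by rw [hdist, h, dist_self])
  -- An arbitrary domain is attached to each `b`; by `hcongr` the class of the resulting family does
  -- not depend on it.
  choose D hD using fun (s : L.Srt) (b : B.carrier s) => B.dom_cover b
  let v : ∀ {s : L.Srt}, B.carrier s → B.SVar s := fun {s} b => ⟨(b, D s b), hD s b⟩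
  -- The index set is the set of choices: the coordinate of the image of `b` at a choice `x` is the
  -- value that `x` gives to the variable of `b`.
  refine ⟨A.Choice B, U, ⟨fun s b => UltraCarrier.mk U (v b).family, fun s b b' => hdist _ _,
    fun s E b hb => ?_, fun f b => ?_, fun R b => ?_⟩, fun s a => ?_⟩
  -- This is why there is a variable for every domain containing `b`: the one attached to `E` takes
  -- all its values in `E`.
  · rw [hcongr (v b) ⟨(b, E), hb⟩ rfl]
    exact mk_mem_dom U fun x => x.2 ⟨s, ⟨(b, E), hb⟩⟩
  · rw [ultraproduct_func]
    refine (dist_le_zero.1 (le_of_eq ?_)).symm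
    refine tendsto_nhds_unique (UltraCarrier.tendsto_dist U _ _) ?_
    -- The condition used is the distance between `f` of the variables and the variable of the value
    -- of `f`; at `B` it equals 0.
    have := hU _ _ ((MetricStructure.Embedding.IsTermValue.func f fun j =>
      i.isTermValue_var (v (b j))).dist (i.isTermValue_var (v (B.func f b))))
    rw [dist_self] at this
    exact this
  · rw [ultraproduct_rel]
    exact tendsto_nhds_unique (BoundedFamily.tendsto_rel U R _)
      (hU _ _ (MetricStructure.Embedding.IsTermValue.rel R fun j => i.isTermValue_var (v (b j))))
  · refine dist_le_zero.1 (le_of_eq ?_)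
    refine tendsto_nhds_unique (UltraCarrier.tendsto_dist U _ _) ?_
    have := hU _ _ ((i.isTermValue_var (v (i.toFun s a))).dist (i.isTermValue_param a))
    rw [dist_self] at this
    exact this

end Witness

/-! ## Embeddings of ultraproducts -/

section Embeddings

variable {L : MetricLanguage.{u}}

def MetricStructure.Embedding.comp {M N P : MetricStructure.{u, w} L} (g : N.Embedding P)
    (f : M.Embedding N) : M.Embedding P where
  toFun s x := g.toFun s (f.toFun s x)
  map_dist s x y := (g.map_dist s _ _).trans (f.map_dist s x y)
  map_dom s D x h := g.map_dom s D _ (f.map_dom s D x h)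
  map_func F x := (congrArg (g.toFun _) (f.map_func F x)).trans (g.map_func F _)
  map_rel R x := (g.map_rel R _).trans (f.map_rel R x)

theorem MetricStructure.Embedding.injective {M N : MetricStructure.{u, w} L} (f : M.Embedding N)
    (s : L.Srt) : Function.Injective (f.toFun s) := fun x y h =>
  dist_le_zero.1 (by rw [← f.map_dist, h, dist_self])

/-- The inverse of a surjective embedding reflecting the domains. -/
theorem MetricStructure.Embedding.exists_inverse {M N : MetricStructure.{u, w} L}
    (f : M.Embedding N) (hf : ∀ s, Function.Surjective (f.toFun s))
    (hdom : ∀ (s : L.Srt) (D : L.Dom s) (x : M.carrier s), f.toFun s x ∈ N.dom D → x ∈ M.dom D) :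
    Nonempty (N.Embedding M) := by
  choose g hg using hf
  exact ⟨{
    toFun := fun s => g s
    map_dist := fun s x y => by rw [← f.map_dist, hg, hg]
    map_dom := fun s D x hx => hdom s D _ (by rwa [hg])
    map_func := fun F x => f.injective _ (by
      rw [hg, f.map_func]
      exact congrArg (N.func F) (funext fun j => (hg _ _).symm))
    map_rel := fun R x => by
      rw [← f.map_rel]
      exact congrArg (N.rel R) (funext fun j => hg _ _) }⟩

variable {I : Type w'} (U : Ultrafilter I)

/-- An embedding of an ultraproduct, given on bounded families. -/
noncomputable def MetricStructure.Embedding.ofFamilies {N : I → MetricStructure.{u, w} L}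
    {P : MetricStructure.{u, max w w'} L} (F : ∀ s, BoundedFamily N s → P.carrier s)
    (hdist : ∀ s x y, dist (F s x) (F s y) = dist (UltraCarrier.mk U x) (UltraCarrier.mk U y))
    (hdom : ∀ s (D : L.Dom s) (x : BoundedFamily N s), (∀ i, x.1 i ∈ (N i).dom D) →
      F s x ∈ P.dom D)
    (hfunc : ∀ f x, F _ (BoundedFamily.func f x) = P.func f fun j => F _ (x j))
    (hrel : ∀ (R : L.Rel) (x : ∀ j, BoundedFamily N (L.relIn R j)),
      P.rel R (fun j => F _ (x j)) = ultraLim U fun i => (N i).rel R fun j => (x j).1 i) :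
    (ultraproduct U N).Embedding P where
  toFun s q := F s (UltraCarrier.rep q)
  map_dist s x y := (hdist s _ _).trans
    (congrArg₂ dist (UltraCarrier.mk_rep (U := U) x) (UltraCarrier.mk_rep (U := U) y))
  map_dom s D q hq := by
    obtain ⟨x, hx, rfl⟩ := hq
    -- The chosen representative need not stay in `D`, but `hdist` makes `F` constant on classes.
    have h : F s (UltraCarrier.mk U x).rep = F s x :=
      dist_le_zero.1 (by rw [hdist, UltraCarrier.mk_rep, dist_self])
    rw [h]
    exact hdom s D x hx
  map_func f q := by
    rw [← hfunc]
    refine dist_le_zero.1 (le_of_eq ((hdist _ _ _).trans ?_))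
    exact (congrArg (dist · _) (UltraCarrier.mk_rep _)).trans (dist_self _)
  map_rel R q := hrel R _

theorem MetricStructure.Embedding.ofFamilies_mk {N : I → MetricStructure.{u, w} L}
    {P : MetricStructure.{u, max w w'} L} (F : ∀ s, BoundedFamily N s → P.carrier s)
    (hdist hdom hfunc hrel) {s : L.Srt} (x : BoundedFamily N s) :
    (ofFamilies U F hdist hdom hfunc hrel).toFun s (UltraCarrier.mk U x) = F s x :=
  dist_le_zero.1 (by
    refine le_of_eq ((hdist s _ _).trans ?_)
    rw [UltraCarrier.mk_rep, dist_self])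

/-- Coordinatewise application of embeddings. -/
def BoundedFamily.map {M N : I → MetricStructure.{u, w} L} (j : ∀ i, (M i).Embedding (N i))
    {s : L.Srt} (x : BoundedFamily M s) : BoundedFamily N s :=
  ⟨fun i => (j i).toFun s (x.1 i), x.2.imp fun D h i => (j i).map_dom s D _ (h i)⟩

/-- The embedding of ultraproducts induced by embeddings of the factors. -/
noncomputable def MetricStructure.Embedding.ultraMap {M N : I → MetricStructure.{u, w} L}
    (j : ∀ i, (M i).Embedding (N i)) : (ultraproduct U M).Embedding (ultraproduct U N) :=
  ofFamilies U (fun _ x => UltraCarrier.mk U (x.map j))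
    (fun s x y => congrArg (ultraLim U)
      (funext fun i => (j i).map_dist s (x.1 i) (y.1 i)))
    (fun s D x hx => mk_mem_dom U fun i => (j i).map_dom s D _ (hx i))
    (fun f x => by
      rw [ultraproduct_func]
      exact congrArg _ (Subtype.ext (funext fun i => (j i).map_func f _)))
    fun R x => by
      rw [ultraproduct_rel]
      exact congrArg (ultraLim U) (funext fun i => (j i).map_rel R _)

theorem MetricStructure.Embedding.ultraMap_mk {M N : I → MetricStructure.{u, w} L}
    (j : ∀ i, (M i).Embedding (N i)) {s : L.Srt} (x : BoundedFamily M s) :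
    (ultraMap U j).toFun s (UltraCarrier.mk U x) = UltraCarrier.mk U (x.map j) :=
  ofFamilies_mk U _ _ _ _ _ x

theorem ultraLim_const (c : ℝ) : ultraLim U (fun _ => c) = c :=
  (tendsto_const_nhds (x := c)).limUnder_eq

end Embeddings

/-- The diagonal embedding into an ultrapower. -/
noncomputable def MetricStructure.Embedding.diagonal {L : MetricLanguage.{u}} {I : Type w}
    (U : Ultrafilter I) (M : MetricStructure.{u, w} L) :
    M.Embedding (ultraproduct U fun _ => M) where
  toFun _ x := UltraCarrier.mk U (BoundedFamily.const I M x)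
  map_dist s x y := ultraLim_const U (dist x y)
  map_dom s D x hx := mk_mem_dom U fun _ => hx
  map_func f x := by
    rw [ultraproduct_func]
    rfl
  map_rel R x := by
    rw [ultraproduct_rel]
    exact ultraLim_const U (M.rel R x)

/-- In the ultrapower of `N`, the diagonal copy of `N` meets the ultrapower of `M` in `M`. -/
theorem MetricStructure.Embedding.mem_range_of_ultraMap_eq {L : MetricLanguage.{u}} {I : Type w}
    (U : Ultrafilter I) {M N : MetricStructure.{u, w} L} (j : M.Embedding N) {s : L.Srt}
    {q : UltraCarrier U (fun _ => M) s} {c : N.carrier s}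
    (h : (ultraMap U fun _ => j).toFun s q = (diagonal U N).toFun s c) :
    c ∈ Set.range (j.toFun s) := by
  obtain ⟨x, rfl⟩ := UltraCarrier.mk_surjective U q
  rw [ultraMap_mk] at h
  have ht := UltraCarrier.tendsto_dist U (x.map fun _ => j) (BoundedFamily.const I N c)
  rw [show UltraCarrier.mk U (x.map fun _ => j) = UltraCarrier.mk U (BoundedFamily.const I N c)
    from h, dist_self] at ht
  have ht' : Tendsto (fun i => j.toFun s (x.1 i)) U (𝓝 c) := tendsto_iff_dist_tendsto_zero.2 ht
  obtain ⟨D, hD⟩ := x.2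
  -- The family lies in one domain, whose isometric image is complete and therefore closed; so the
  -- limit `c` stays in the image of `j`.
  have hc : IsComplete (j.toFun s '' M.dom D) :=
    (isComplete_image_iff
      (Isometry.of_dist_eq (j.map_dist s)).isUniformInducing).2
      (M.dom_complete D)
  obtain ⟨a, -, ha⟩ := hc.isClosed.mem_of_tendsto ht'
    (Eventually.of_forall fun i => ⟨x.1 i, hD i, rfl⟩)
  exact ⟨a, ha⟩

/-- Models of a theory: existentially closed models are strong amalgamation bases. -/
theorem MetricStructure.exists_strong_amalgam {L : MetricLanguage.{u}}
    {A B C : MetricStructure.{u, max u w} L} (i : A.Embedding B) (hi : i.IsExistentiallyClosed)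
    (j : A.Embedding C) : ∃ (I : Type (max u w)) (U : Ultrafilter I)
      (f : B.Embedding (ultraproduct U fun _ => C)) (g : C.Embedding (ultraproduct U fun _ => C)),
      (∀ (s : L.Srt) (a : A.carrier s), f.toFun s (i.toFun s a) = g.toFun s (j.toFun s a)) ∧
      ∀ s : L.Srt, Set.range (f.toFun s) ∩ Set.range (g.toFun s) =
        Set.range fun a : A.carrier s => f.toFun s (i.toFun s a) := by
  obtain ⟨I, U, h, hh⟩ := hi.exists_ultrapower
  have hcomm : ∀ (s : L.Srt) (a : A.carrier s),
      ((Embedding.ultraMap U fun _ => j).comp h).toFun s (i.toFun s a) =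
        (Embedding.diagonal U C).toFun s (j.toFun s a) := fun s a =>
    (congrArg _ (hh s a)).trans (Embedding.ultraMap_mk U _ _)
  -- `B` factors through the ultrapower of `A`, so it can meet the diagonal copy of `C` only in the
  -- image of `A`.
  refine ⟨I, U, (Embedding.ultraMap U fun _ => j).comp h, .diagonal U C, hcomm, fun s => ?_⟩
  refine Set.Subset.antisymm ?_ ?_
  · rintro _ ⟨⟨b, rfl⟩, c, hc⟩
    obtain ⟨a, rfl⟩ := j.mem_range_of_ultraMap_eq U hc.symm
    exact ⟨a, (hcomm s a).trans hc⟩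
  · rintro _ ⟨a, rfl⟩
    exact ⟨⟨_, rfl⟩, _, (hcomm s a).symm⟩

theorem MetricStructure.IsECMember.isStrongAmalgamationBase_Mod {L : MetricLanguage.{u}}
    {T : Set L.Sentence} {A : MetricStructure.{u, max u w} L} (hA : IsECMember (Mod T) A) :
    IsStrongAmalgamationBase (Mod T) A := by
  refine ⟨hA.1, fun B hB C hC i j => ?_⟩
  obtain ⟨I, U, f, g, h, h'⟩ := exists_strong_amalgam.{u, w} i (hA.2 B hB i) j
  exact ⟨_, ultraproduct_mem_Mod U fun _ => hC, f, g, h, h'⟩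

/-! ## Iterated ultraproducts -/

section Iterated

variable {L : MetricLanguage.{u}} {I J : Type w} (U : Ultrafilter I) (V : Ultrafilter J)

/-- The sets `S` such that `(i, j) ∈ S` for `U`-almost all `i` and `V`-almost all `j`. -/
def Ultrafilter.iterated : Ultrafilter (I × J) := U.bind fun i => V.map (Prod.mk i)

theorem Ultrafilter.mem_iterated {S : Set (I × J)} :
    S ∈ U.iterated V ↔ ∀ᶠ i in (U : Filter I), ∀ᶠ j in (V : Filter J), (i, j) ∈ S := Iff.rfl

/-- If a single pair were a large set, some row of it would be `V`-large, so `V` would concentrate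
on one point. -/
theorem Ultrafilter.iterated_ne_pure (hV : ∀ j, V ≠ pure j) (p : I × J) :
    U.iterated V ≠ pure p := by
  intro h
  have h1 : {p} ∈ U.iterated V := by rw [h]; exact Ultrafilter.mem_pure.2 rfl
  obtain ⟨i, hi⟩ := (U.mem_iterated V |>.1 h1).exists
  refine hV p.2 (Ultrafilter.coe_injective (V.neBot.eq_pure_iff.2 ?_))
  filter_upwards [hi] with j hj
  exact congrArg Prod.snd hj

/-- An open neighbourhood of `l` is also a neighbourhood of `G i` for `U`-almost all `i`; working
with open sets makes regularity of `α` unnecessary. -/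
theorem Ultrafilter.tendsto_iterated {α : Type w'} [TopologicalSpace α] {F : I × J → α}
    {G : I → α} {l : α} (hF : ∀ i, Tendsto (fun j => F (i, j)) V (𝓝 (G i)))
    (hG : Tendsto G U (𝓝 l)) : Tendsto F (U.iterated V) (𝓝 l) := by
  refine tendsto_nhds.2 fun O hO hl => (U.mem_iterated V).2 ?_
  filter_upwards [hG.eventually_mem (hO.mem_nhds hl)] with i hi
  exact (hF i).eventually_mem (hO.mem_nhds hi)

variable {N : I → J → MetricStructure.{u, w} L}

/-- The restriction of a doubly indexed family to one row. -/
def BoundedFamily.row {s : L.Srt} (y : BoundedFamily (fun p : I × J => N p.1 p.2) s) (i : I) :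
    BoundedFamily (N i) s :=
  ⟨fun j => y.1 (i, j), y.2.imp fun _ h j => h (i, j)⟩

/-- Rows can be represented separately because they share the domain `D`, which then bounds the
whole doubly indexed family. -/
theorem BoundedFamily.exists_rows {s : L.Srt} {D : L.Dom s}
    (q : BoundedFamily (fun i => MetricStructure.ultraproduct V (N i)) s)
    (hq : ∀ i, q.1 i ∈ (MetricStructure.ultraproduct V (N i)).dom D) :
    ∃ y : BoundedFamily (fun p : I × J => N p.1 p.2) s,
      (∀ p, y.1 p ∈ (N p.1 p.2).dom D) ∧ ∀ i, UltraCarrier.mk V (y.row i) = q.1 i := by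
  choose y hy hyq using hq
  exact ⟨⟨fun p => (y p.1).1 p.2, D, fun p => hy p.1 p.2⟩, fun p => hy p.1 p.2, hyq⟩

/-- Distances and predicates in the iterated ultraproduct are limits of limits, hence limits along
the iterated ultrafilter. An embedding is all that the amalgamation needs. -/
theorem MetricStructure.nonempty_embedding_iterated :
    Nonempty ((ultraproduct U fun i => ultraproduct V (N i)).Embedding
      (ultraproduct (U.iterated V) fun p : I × J => N p.1 p.2)) := by
  have hex : ∀ (s : L.Srt) (q : BoundedFamily (fun i => ultraproduct V (N i)) s),
      ∃ y : BoundedFamily (fun p : I × J => N p.1 p.2) s,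
        ∀ i, UltraCarrier.mk V (y.row i) = q.1 i := fun s q => by
    obtain ⟨D, hD⟩ := q.2
    obtain ⟨y, -, hy⟩ := q.exists_rows V hD
    exact ⟨y, hy⟩
  choose Y hY using hex
  have hdist : ∀ (s : L.Srt) (q q' : BoundedFamily (fun i => ultraproduct V (N i)) s)
      (y y' : BoundedFamily (fun p : I × J => N p.1 p.2) s),
      (∀ i, UltraCarrier.mk V (y.row i) = q.1 i) → (∀ i, UltraCarrier.mk V (y'.row i) = q'.1 i) →
      dist (UltraCarrier.mk (U.iterated V) y) (UltraCarrier.mk (U.iterated V) y') =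
        dist (UltraCarrier.mk U q) (UltraCarrier.mk U q') := by
    intro s q q' y y' hy hy'
    refine tendsto_nhds_unique (UltraCarrier.tendsto_dist _ y y')
      (U.tendsto_iterated V (fun i => ?_) (UltraCarrier.tendsto_dist U q q'))
    rw [← hy, ← hy']
    exact UltraCarrier.tendsto_dist V (y.row i) (y'.row i)
  -- The selected lift `Y s q` may be exchanged for any other lift, in particular for one lying in a
  -- prescribed domain or computed coordinatewise.
  have hmk : ∀ (s : L.Srt) (q : BoundedFamily (fun i => ultraproduct V (N i)) s)
      (y : BoundedFamily (fun p : I × J => N p.1 p.2) s),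
      (∀ i, UltraCarrier.mk V (y.row i) = q.1 i) →
      UltraCarrier.mk (U.iterated V) (Y s q) = UltraCarrier.mk (U.iterated V) y :=
    fun s q y hy => dist_le_zero.1 (by rw [hdist s q q _ _ (hY s q) hy, dist_self])
  refine ⟨.ofFamilies U (fun s q => UltraCarrier.mk (U.iterated V) (Y s q))
    (fun s q q' => hdist s q q' _ _ (hY s q) (hY s q')) (fun s D q hq => ?_) (fun f q => ?_)
    fun R q => ?_⟩
  · obtain ⟨y, hyD, hy⟩ := q.exists_rows V hq
    rw [hmk s q y hy]
    exact mk_mem_dom _ hyD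
  · rw [ultraproduct_func]
    refine hmk _ _ _ fun i => ?_
    have h := ultraproduct_func V f fun j => (Y _ (q j)).row i
    exact h.symm.trans (congrArg ((ultraproduct V (N i)).func f) (funext fun j => hY _ (q j) i))
  · rw [ultraproduct_rel]
    refine tendsto_nhds_unique (BoundedFamily.tendsto_rel _ R fun j => Y _ (q j))
      (U.tendsto_iterated V (fun i => ?_) (BoundedFamily.tendsto_rel U R q))
    have h := ultraproduct_rel V R fun j => (Y _ (q j)).row i
    rw [← show (fun j => UltraCarrier.mk V ((Y _ (q j)).row i)) = fun j => (q j).1 i from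
      funext fun j => hY _ (q j) i, h]
    exact BoundedFamily.tendsto_rel V R fun j => (Y _ (q j)).row i

end Iterated

/-! ## Approximate polar decomposition -/

open scoped ComplexOrder in
-- From `x* x ≤ 1` by the C*-identity.
theorem TracialVNA.norm_op_le_one (M : TracialVNA.{w}) (x y : M.Elem)
    (h : star x * x + star y * y = 1) : ‖x.op‖ ≤ 1 := by
  have h1 : star x.op * x.op + star y.op * y.op = 1 := congrArg TracialVNA.Elem.op h
  have h2 : star x.op * x.op ≤ 1 := by
    rw [← h1]
    exact le_add_of_nonneg_right (star_mul_self_nonneg _)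
  have h3 := (CStarAlgebra.norm_le_one_iff_of_nonneg (star x.op * x.op)
    (star_mul_self_nonneg _)).2 h2
  rw [CStarRing.norm_star_mul_self] at h3
  nlinarith [norm_nonneg x.op]

theorem TracialVNA.abs_trace_re_le (M : TracialVNA.{w}) (x : M.Elem) (r : ℝ) (hx : ‖x.op‖ ≤ r) :
    |(M.trace x).re| ≤ r :=
  (Complex.abs_re_le_norm _).trans ((M.norm_trace_le x).trans (M.norm_le x r hx))

open scoped ComplexOrder in
-- With `a = η* η + ε²`, take `k = a^(1/4)` and `t = a^(-1/2)`. The shift by `ε²` makes `a`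
-- invertible, so continuous functional calculus is enough and no partial isometries occur.
theorem TracialVNA.exists_invertible_sqrt (M : TracialVNA.{w}) (η : M.Elem) {ε : ℝ} (hε : 0 < ε) :
    ∃ k t : M.Elem, star k = k ∧ star t = t ∧ k * k * t = 1 ∧ t * (k * k) = 1 ∧
      k * k * (k * k) = star η * η + ((ε : ℂ) ^ 2) • 1 ∧ ‖k.op‖ ^ 2 ≤ ‖η.op‖ + ε := by
  set a : M.H →L[ℂ] M.H := star η.op * η.op + algebraMap ℝ (M.H →L[ℂ] M.H) (ε ^ 2) with ha
  have hpos : IsStrictlyPositive a :=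
    (isStrictlyPositive_algebraMap (A := M.H →L[ℂ] M.H) (c := ε ^ 2) (by positivity)).of_le
      (le_add_of_nonneg_left (star_mul_self_nonneg _))
  have ha0 : 0 ≤ a := hpos.nonneg
  set s := CFC.sqrt a with hs
  set k := CFC.sqrt s with hk
  have hs0 : 0 ≤ s := CFC.sqrt_nonneg a
  have hk0 : 0 ≤ k := CFC.sqrt_nonneg s
  have hss : s * s = a := CFC.sqrt_mul_sqrt_self a ha0
  have hkk : k * k = s := CFC.sqrt_mul_sqrt_self s hs0
  have hsu : IsUnit s := CFC.isUnit_sqrt_iff_isStrictlyPositive.2 hpos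
  obtain ⟨v, hv⟩ := hsu
  have hsstar : star s = s := hs0.isSelfAdjoint.star_eq
  have hkstar : star k = k := hk0.isSelfAdjoint.star_eq
  -- Roots and inverses commute with whatever commutes with `a`, so they belong to `M` by the
  -- bicommutant property.
  have hcomm : ∀ z ∈ M.alg.commutant, Commute s z := by
    intro z hz
    have h1 : η.op * z = z * η.op := VonNeumannAlgebra.mem_commutant_iff.1 hz _ (M.op_mem η)
    have h2 : star η.op * z = z * star η.op :=
      VonNeumannAlgebra.mem_commutant_iff.1 hz _ (M.op_mem (star η))
    have h3 : Commute a z := Commute.add_left (Commute.mul_left h2 h1) (Algebra.commutes _ _)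
    exact Commute.cfcₙ_nnreal h3 NNReal.sqrt
  obtain ⟨K, hK⟩ := M.exists_elem k fun z hz =>
    (Commute.cfcₙ_nnreal (hcomm z hz) NNReal.sqrt).symm
  obtain ⟨t, ht⟩ := M.exists_elem ↑v⁻¹ fun z hz => by
    have : Commute (v : M.H →L[ℂ] M.H) z := by rw [hv]; exact hcomm z hz
    exact this.units_inv_left.symm
  have hvs : star (↑v⁻¹ : M.H →L[ℂ] M.H) = ↑v⁻¹ := by
    have : star v = v := Units.ext (by rw [Units.coe_star, hv, hsstar])
    rw [← Units.coe_star_inv, this]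
  refine ⟨K, t, op_injective ?_, op_injective ?_, op_injective ?_, op_injective ?_,
    op_injective ?_, ?_⟩
  · rw [op_star, hK, hkstar]
  · rw [op_star, ht, hvs]
  · rw [op_mul, op_mul, hK, ht, hkk, ← hv, op_one, Units.mul_inv]
  · rw [op_mul, op_mul, hK, ht, hkk, ← hv, op_one, Units.inv_mul]
  · rw [op_mul, op_mul, hK, hkk, hss, ha, op_add, op_mul, op_star, op_smul, op_one,
      Algebra.algebraMap_eq_smul_one]
    congr 1
    ext v
    simp [← Complex.coe_smul]
  · have h1 : ‖k‖ ^ 2 = ‖s‖ := by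
      rw [sq, ← CStarRing.norm_star_mul_self, hkstar, hkk]
    have h2 : ‖s‖ ^ 2 = ‖a‖ := by
      rw [sq, ← CStarRing.norm_star_mul_self, hsstar, hss]
    have h3 : ‖a‖ ≤ ‖η.op‖ ^ 2 + ε ^ 2 := by
      refine (norm_add_le _ _).trans (add_le_add ?_ ?_)
      · rw [CStarRing.norm_star_mul_self, sq]
      · refine (norm_algebraMap _ _).le.trans ?_
        rw [Real.norm_of_nonneg (by positivity)]
        exact mul_le_of_le_one_right (by positivity) ContinuousLinearMap.norm_id_le
    rw [hK, h1]
    -- After squaring: `‖a‖ ≤ ‖η‖² + ε² ≤ (‖η‖ + ε)²`.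
    refine abs_le_of_sq_le_sq' ?_ (by positivity) |>.2
    nlinarith [norm_nonneg η.op]

/-- An approximate polar decomposition `η = w k²`. -/
theorem TracialVNA.exists_approx_polar (M : TracialVNA.{w}) (η : M.Elem) {ε : ℝ} (hε : 0 < ε) :
    ∃ w k : M.Elem, ‖w.op‖ ≤ 1 ∧ star k = k ∧ ‖k.op‖ ^ 2 ≤ ‖η.op‖ + ε ∧ η = w * k * k ∧
      (M.trace (k * k)).re ≤ (M.trace (star η * w)).re + ε := by
  obtain ⟨k, t, hk, ht, hst, hts, hss, hn⟩ := M.exists_invertible_sqrt η hε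
  have hηη : star η * η = k * k * (k * k) - ((ε : ℂ) ^ 2) • 1 := by rw [hss, add_sub_cancel_right]
  -- This is `t (η* η + ε²) t = 1`; it shows that both `w = η t` and `ε t` are contractions.
  have hsum : star (η * t) * (η * t) + star ((ε : ℂ) • t) * ((ε : ℂ) • t) = 1 := by
    have e1 : star (η * t) * (η * t) = t * (star η * η) * t := by
      rw [star_mul, ht]; noncomm_ring
    have e2 : star ((ε : ℂ) • t) * ((ε : ℂ) • t) = ((ε : ℂ) ^ 2) • (t * t) := by
      rw [star_smul, ht, smul_mul_smul_comm, Complex.star_def, Complex.conj_ofReal, sq]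
    rw [e1, e2, hηη, mul_sub, sub_mul, mul_smul_comm, smul_mul_assoc, mul_one, sub_add_cancel,
      mul_assoc, mul_assoc (k * k), hst, mul_one, hts]
  refine ⟨η * t, k, M.norm_op_le_one _ _ hsum, hk, hn, by
    rw [mul_assoc, mul_assoc, hts, mul_one], ?_⟩
  have hu : ‖((ε : ℂ) • t).op‖ ≤ 1 := M.norm_op_le_one _ (η * t) (by rw [add_comm]; exact hsum)
  -- So `tr(k²)` exceeds `tr(η* w)` by `ε tr(ε t)`, whose real part is at most `ε`.
  have e : star η * (η * t) = k * k - (ε : ℂ) • ((ε : ℂ) • t) := by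
    rw [← mul_assoc, hηη, sub_mul, mul_assoc (k * k), hst, mul_one, smul_mul_assoc, one_mul,
      smul_smul, sq]
  have h1 := abs_le.1 (M.abs_trace_re_le _ _ hu)
  rw [e, map_sub, map_smul _ (ε : ℂ) ((ε : ℂ) • t), smul_eq_mul, Complex.sub_re,
    Complex.re_ofReal_mul]
  nlinarith [h1.2]

/-! ## Tracial ultraproducts are von Neumann algebras -/

/-- Projection to a complete convex subset of a complex Hilbert space. -/
theorem exists_re_inner_sub_le_zero {H : Type w} [NormedAddCommGroup H] [InnerProductSpace ℂ H]
    {K : Set H} (hne : K.Nonempty) (hK : IsComplete K)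
    (hconv : ∀ x ∈ K, ∀ y ∈ K, ∀ a b : ℝ, 0 ≤ a → 0 ≤ b → a + b = 1 →
      (a : ℂ) • x + (b : ℂ) • y ∈ K) (ξ : H) :
    ∃ p ∈ K, ∀ v ∈ K, (inner ℂ (ξ - p) (v - p)).re ≤ 0 := by
  let : InnerProductSpace ℝ H := InnerProductSpace.complexToReal
  have hc : Convex ℝ K := fun x hx y hy a b ha hb hab => by
    have := hconv x hx y hy a b ha hb hab
    rwa [Complex.coe_smul, Complex.coe_smul] at this
  obtain ⟨p, hp, hmin⟩ := exists_norm_eq_iInf_of_complete_convex hne hK hc ξ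
  exact ⟨p, hp, (norm_eq_iInf_iff_real_inner_le_zero hc hp).1 hmin⟩

section TracialUltraproduct

open UniformSpace

/-- The `*`-algebra of families bounded in operator norm. -/
def TracialVNA.boundedSubalgebra {I : Type w} (M : I → TracialVNA.{w}) :
    StarSubalgebra ℂ (∀ i, (M i).Elem) where
  carrier := {x | ∃ n : ℕ, ∀ i, x i ∈ (M i).opBall n}
  mul_mem' := by
    rintro x y ⟨m, hx⟩ ⟨n, hy⟩
    refine ⟨m * n, fun i => ?_⟩
    simp only [opBall, Set.mem_ofPred_eq, Pi.mul_apply, op_mul, Nat.cast_mul]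
    exact (norm_mul_le _ _).trans (mul_le_mul (hx i) (hy i) (norm_nonneg _) (Nat.cast_nonneg _))
  add_mem' := by
    rintro x y ⟨m, hx⟩ ⟨n, hy⟩
    refine ⟨m + n, fun i => ?_⟩
    simp only [opBall, Set.mem_ofPred_eq, Pi.add_apply, op_add, Nat.cast_add]
    exact (norm_add_le _ _).trans (add_le_add (hx i) (hy i))
  algebraMap_mem' c := by
    refine ⟨⌈‖c‖⌉₊, fun i => ?_⟩
    simp only [opBall, Set.mem_ofPred_eq, Pi.algebraMap_apply, Algebra.algebraMap_eq_smul_one,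
      op_smul, norm_smul, op_one]
    exact (mul_le_of_le_one_right (norm_nonneg _) ContinuousLinearMap.norm_id_le).trans
      (Nat.le_ceil _)
  star_mem' := by
    rintro x ⟨m, hx⟩
    refine ⟨m, fun i => ?_⟩
    simp only [opBall, Set.mem_ofPred_eq, Pi.star_apply, op_star, _root_.norm_star]
    exact hx i

/-- The `*`-algebra of families bounded in operator norm; this type carries the seminorm
`lim_U ‖xᵢ‖₂`. -/
@[nolint unusedArguments]
def TracialVNA.Bdd {I : Type w} (_U : Ultrafilter I) (M : I → TracialVNA.{w}) : Type w :=
  TracialVNA.boundedSubalgebra M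

variable {I : Type w} {U : Ultrafilter I} {M : I → TracialVNA.{w}}

noncomputable instance TracialVNA.Bdd.instRing : Ring (TracialVNA.Bdd U M) :=
  inferInstanceAs (Ring (TracialVNA.boundedSubalgebra M))
noncomputable instance TracialVNA.Bdd.instStarRing : StarRing (TracialVNA.Bdd U M) :=
  inferInstanceAs (StarRing (TracialVNA.boundedSubalgebra M))
noncomputable instance TracialVNA.Bdd.instAlgebra : Algebra ℂ (TracialVNA.Bdd U M) :=
  inferInstanceAs (Algebra ℂ (TracialVNA.boundedSubalgebra M))
instance TracialVNA.Bdd.instStarModule : StarModule ℂ (TracialVNA.Bdd U M) :=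
  inferInstanceAs (StarModule ℂ (TracialVNA.boundedSubalgebra M))

/-! ### Bounded families, their limit trace and their representation on `L²`. -/

namespace TracialVNA.Bdd

/-- The coordinates of a bounded family. -/
def coord (x : Bdd U M) (i : I) : (M i).Elem := x.1 i

variable (U) in
/-- A family bounded in operator norm. -/
def of (x : ∀ i, (M i).Elem) (n : ℕ) (hx : ∀ i, x i ∈ (M i).opBall n) : Bdd U M := ⟨x, n, hx⟩

theorem exists_bound (x : Bdd U M) : ∃ n : ℕ, ∀ i, ‖(x.coord i).op‖ ≤ n := x.2

theorem ext {x y : Bdd U M} (h : ∀ i, x.coord i = y.coord i) : x = y := Subtype.ext (funext h)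

theorem coord_zero (i : I) : (0 : Bdd U M).coord i = 0 := rfl
theorem coord_add (x y : Bdd U M) (i : I) : (x + y).coord i = x.coord i + y.coord i := rfl
theorem coord_mul (x y : Bdd U M) (i : I) : (x * y).coord i = x.coord i * y.coord i := rfl
theorem coord_star (x : Bdd U M) (i : I) : (star x).coord i = star (x.coord i) := rfl
theorem coord_smul (c : ℂ) (x : Bdd U M) (i : I) : (c • x).coord i = c • x.coord i := rfl

/-- The trace `lim_U tr xᵢ`. -/
noncomputable def trace (x : Bdd U M) : ℂ := limUnder (U : Filter I) fun i => (M i).trace (x.coord i)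

theorem tendsto_trace (x : Bdd U M) :
    Tendsto (fun i => (M i).trace (x.coord i)) U (𝓝 x.trace) := by
  obtain ⟨n, hn⟩ := x.exists_bound
  obtain ⟨c, -, hc⟩ := (isCompact_closedBall (0 : ℂ) n).ultrafilter_le_nhds
    (U.map fun i => (M i).trace (x.coord i)) (by
      rw [le_principal_iff]
      refine Filter.mem_map.2 (Filter.univ_mem' fun i => ?_)
      have := ((M i).norm_trace_le _).trans ((M i).norm_le _ _ (hn i))
      simpa using this)
  exact tendsto_nhds_limUnder ⟨c, hc⟩

theorem trace_add (x y : Bdd U M) : (x + y).trace = x.trace + y.trace :=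
  tendsto_nhds_unique (x + y).tendsto_trace
    ((x.tendsto_trace.add y.tendsto_trace).congr fun i => by rw [coord_add, map_add])

theorem trace_smul (c : ℂ) (x : Bdd U M) : (c • x).trace = c * x.trace :=
  tendsto_nhds_unique (c • x).tendsto_trace
    ((x.tendsto_trace.const_mul c).congr fun i => by rw [coord_smul, map_smul, smul_eq_mul])

theorem trace_star (x : Bdd U M) : (star x).trace = starRingEnd ℂ x.trace :=
  tendsto_nhds_unique (star x).tendsto_trace
    (((Complex.continuous_conj.tendsto _).comp x.tendsto_trace).congr fun i => by
      rw [coord_star, (M i).trace_star]; rfl)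

theorem trace_mul_comm (x y : Bdd U M) : (x * y).trace = (y * x).trace :=
  tendsto_nhds_unique (x * y).tendsto_trace
    ((y * x).tendsto_trace.congr fun i => by
      rw [coord_mul, coord_mul]; exact (M i).tr_comm _ _)

theorem trace_one : (1 : Bdd U M).trace = 1 :=
  tendsto_nhds_unique (1 : Bdd U M).tendsto_trace
    (tendsto_const_nhds.congr fun i => ((M i).tr_one).symm)

theorem trace_star_mul_self_nonneg (x : Bdd U M) : 0 ≤ (star x * x).trace.re :=
  ge_of_tendsto' ((Complex.continuous_re.tendsto _).comp (star x * x).tendsto_trace)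
    fun i => ((M i).trace_star_mul_self (x.coord i)).1

/-- The inner product `⟪x, y⟫ = lim_U tr (xᵢ* yᵢ)`. -/
noncomputable abbrev preCore : PreInnerProductSpace.Core ℂ (Bdd U M) where
  inner x y := (star x * y).trace
  conj_inner_symm x y := by
    show starRingEnd ℂ (star y * x).trace = (star x * y).trace
    rw [← trace_star, star_mul, star_star]
  re_inner_nonneg x := x.trace_star_mul_self_nonneg
  add_left x y z := by
    show (star (x + y) * z).trace = (star x * z).trace + (star y * z).trace
    rw [star_add, add_mul, trace_add]
  smul_left x y c := by
    show (star (c • x) * y).trace = starRingEnd ℂ c * (star x * y).trace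
    rw [star_smul, smul_mul_assoc, trace_smul]; rfl

noncomputable instance instSeminormed : SeminormedAddCommGroup (Bdd U M) :=
  @InnerProductSpace.Core.toSeminormedAddCommGroup ℂ _ _ _ _ preCore

noncomputable instance instInner : InnerProductSpace ℂ (Bdd U M) :=
  InnerProductSpace.ofCore preCore

theorem inner_def (x y : Bdd U M) : inner ℂ x y = (star x * y).trace := rfl

theorem norm_sq (x : Bdd U M) : ‖x‖ ^ 2 = (star x * x).trace.re := by
  rw [← inner_def, @norm_sq_eq_re_inner ℂ]; rfl

theorem tendsto_norm (x : Bdd U M) : Tendsto (fun i => ‖x.coord i‖) U (𝓝 ‖x‖) := by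
  have h : Tendsto (fun i => ‖x.coord i‖ ^ 2) U (𝓝 (‖x‖ ^ 2)) := by
    rw [norm_sq]
    exact ((Complex.continuous_re.tendsto _).comp (star x * x).tendsto_trace).congr
      fun i => ((M i).norm_sq _).symm
  have h2 := (Real.continuous_sqrt.tendsto _).comp h
  rw [Real.sqrt_sq (norm_nonneg _)] at h2
  exact h2.congr fun i => Real.sqrt_sq (norm_nonneg _)

theorem norm_one : ‖(1 : Bdd U M)‖ = 1 := by
  have h := norm_sq (1 : Bdd U M)
  rw [star_one, one_mul, trace_one, Complex.one_re] at h
  nlinarith [norm_nonneg (1 : Bdd U M)]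

theorem norm_mul_le_left (x y : Bdd U M) (r : ℝ) (hx : ∀ i, ‖(x.coord i).op‖ ≤ r) :
    ‖x * y‖ ≤ r * ‖y‖ :=
  le_of_tendsto_of_tendsto' (x * y).tendsto_norm (y.tendsto_norm.const_mul r)
    fun i => (M i).norm_mul_le_left _ _ r (hx i)

theorem norm_mul_le_right (x y : Bdd U M) (r : ℝ) (hy : ∀ i, ‖(y.coord i).op‖ ≤ r) :
    ‖x * y‖ ≤ r * ‖x‖ :=
  le_of_tendsto_of_tendsto' (x * y).tendsto_norm (x.tendsto_norm.const_mul r)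
    fun i => (M i).norm_mul_le_right _ _ r (hy i)

theorem norm_le (x : Bdd U M) (r : ℝ) (hx : ∀ i, ‖(x.coord i).op‖ ≤ r) : ‖x‖ ≤ r := by
  simpa [norm_one] using norm_mul_le_left x 1 r hx

/-- The `L²`-space of the ultraproduct. -/
abbrev L2 (U : Ultrafilter I) (M : I → TracialVNA.{w}) : Type w := Completion (Bdd U M)

noncomputable def mulLeft (x : Bdd U M) : Bdd U M →L[ℂ] Bdd U M :=
  (LinearMap.mulLeft ℂ x).mkContinuousOfExistsBound
    (x.exists_bound.elim fun n hn => ⟨n, fun y => norm_mul_le_left x y n hn⟩)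

noncomputable def mulRight (x : Bdd U M) : Bdd U M →L[ℂ] Bdd U M :=
  (LinearMap.mulRight ℂ x).mkContinuousOfExistsBound
    (x.exists_bound.elim fun n hn => ⟨n, fun y => norm_mul_le_right y x n hn⟩)

/-- Left multiplication on `L²`. -/
noncomputable def left (x : Bdd U M) : L2 U M →L[ℂ] L2 U M := x.mulLeft.completion

/-- Right multiplication on `L²`. -/
noncomputable def right (x : Bdd U M) : L2 U M →L[ℂ] L2 U M := x.mulRight.completion

theorem left_coe (x y : Bdd U M) : x.left (y : L2 U M) = ((x * y : Bdd U M) : L2 U M) :=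
  ContinuousLinearMap.completion_apply_coe _ _

theorem right_coe (x y : Bdd U M) : x.right (y : L2 U M) = ((y * x : Bdd U M) : L2 U M) :=
  ContinuousLinearMap.completion_apply_coe _ _

theorem clm_ext {S T : L2 U M →L[ℂ] L2 U M} (h : ∀ y : Bdd U M, S y = T y) : S = T :=
  ContinuousLinearMap.ext fun v => Completion.induction_on v
    (isClosed_eq S.continuous T.continuous) h

theorem left_one : (1 : Bdd U M).left = 1 := clm_ext fun y => by rw [left_coe, one_mul]; rfl

theorem left_zero : (0 : Bdd U M).left = 0 := clm_ext fun y => by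
  rw [left_coe, zero_mul, Completion.coe_zero]; rfl

theorem left_add (x y : Bdd U M) : (x + y).left = x.left + y.left := clm_ext fun z => by
  rw [left_coe, add_mul, Completion.coe_add, add_apply, left_coe, left_coe]

theorem left_sub (x y : Bdd U M) : (x - y).left = x.left - y.left := clm_ext fun z => by
  rw [left_coe, sub_mul, Completion.coe_sub, sub_apply, left_coe, left_coe]

theorem left_smul (c : ℂ) (x : Bdd U M) : (c • x).left = c • x.left := clm_ext fun z => by
  rw [left_coe, smul_mul_assoc, Completion.coe_smul, smul_apply, left_coe]

theorem left_mul (x y : Bdd U M) : (x * y).left = x.left * y.left := clm_ext fun z => by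
  rw [left_coe, mul_apply_eq_comp, left_coe, left_coe, mul_assoc]

theorem right_mul_left (x y : Bdd U M) : y.right * x.left = x.left * y.right :=
  clm_ext fun z => by
    rw [mul_apply_eq_comp, mul_apply_eq_comp, left_coe, right_coe,
      right_coe, left_coe, mul_assoc]

theorem star_eq_of_inner {S T : L2 U M →L[ℂ] L2 U M}
    (h : ∀ y z : Bdd U M, inner ℂ (S y) (z : L2 U M) = inner ℂ (y : L2 U M) (T z)) :
    star T = S := by
  refine ((ContinuousLinearMap.eq_adjoint_iff S T).2 fun v v' => ?_).symm
  refine Completion.induction_on₂ v v' (isClosed_eq ?_ ?_) h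
  · exact (S.continuous.comp continuous_fst).inner continuous_snd
  · exact continuous_fst.inner (T.continuous.comp continuous_snd)

theorem star_left (x : Bdd U M) : star x.left = (star x).left := star_eq_of_inner fun y z => by
  rw [left_coe, left_coe, Completion.inner_coe, Completion.inner_coe, inner_def, inner_def,
    star_mul, star_star, mul_assoc]

/-- Here cyclicity of the trace is essential, in contrast with `star_left`. -/
theorem star_right (x : Bdd U M) : star x.right = (star x).right := star_eq_of_inner fun y z => by
  rw [right_coe, right_coe, Completion.inner_coe, Completion.inner_coe, inner_def, inner_def,
    star_mul, star_star, mul_assoc, trace_mul_comm, mul_assoc]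

theorem norm_left_le (x : Bdd U M) (r : ℝ) (hr : 0 ≤ r) (hx : ∀ i, ‖(x.coord i).op‖ ≤ r) :
    ‖x.left‖ ≤ r := by
  refine ContinuousLinearMap.opNorm_le_bound _ hr fun v => ?_
  refine Completion.induction_on v (isClosed_le (by fun_prop) (by fun_prop)) fun y => ?_
  rw [left_coe, Completion.norm_coe, Completion.norm_coe]
  exact norm_mul_le_left x y r hx

/-- The cyclic vector. -/
noncomputable def vacuum (U : Ultrafilter I) (M : I → TracialVNA.{w}) : L2 U M :=
  ((1 : Bdd U M) : L2 U M)

theorem right_vacuum (x : Bdd U M) : x.right (vacuum U M) = x := by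
  rw [vacuum, right_coe, one_mul]

theorem left_vacuum (x : Bdd U M) : x.left (vacuum U M) = x := by
  rw [vacuum, left_coe, mul_one]

/-- The von Neumann algebra of operators commuting with right multiplications. -/
noncomputable def algebra (U : Ultrafilter I) (M : I → TracialVNA.{w}) :
    VonNeumannAlgebra (L2 U M) where
  __ := StarSubalgebra.centralizer ℂ (Set.range (right : Bdd U M → _))
  centralizer_centralizer' := Set.centralizer_centralizer_centralizer _

/-- The centralizer as a `*`-subalgebra also demands commutation with adjoints; this is automatic
since the adjoint of a right multiplication is a right multiplication. -/
theorem mem_algebra_iff {T : L2 U M →L[ℂ] L2 U M} :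
    T ∈ algebra U M ↔ ∀ y : Bdd U M, y.right * T = T * y.right := by
  refine (StarSubalgebra.mem_centralizer_iff ℂ).trans ⟨fun h y => (h _ ⟨y, rfl⟩).1, ?_⟩
  rintro h _ ⟨y, rfl⟩
  exact ⟨h y, by rw [star_right]; exact h _⟩

theorem left_mem_algebra (x : Bdd U M) : x.left ∈ algebra U M :=
  mem_algebra_iff.2 fun y => right_mul_left x y

/-- The image in `L²` of the ball of radius `n` in operator norm. -/
def ball (U : Ultrafilter I) (M : I → TracialVNA.{w}) (n : ℕ) : Set (L2 U M) :=
  {v | ∃ x : Bdd U M, (∀ i, ‖(x.coord i).op‖ ≤ n) ∧ (x : L2 U M) = v}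

theorem convex_ball (n : ℕ) : ∀ v ∈ ball U M n, ∀ v' ∈ ball U M n, ∀ a b : ℝ, 0 ≤ a → 0 ≤ b →
    a + b = 1 → (a : ℂ) • v + (b : ℂ) • v' ∈ ball U M n := by
  rintro _ ⟨x, hx, rfl⟩ _ ⟨y, hy, rfl⟩ a b ha hb hab
  refine ⟨(a : ℂ) • x + (b : ℂ) • y, fun i => ?_, ?_⟩
  · rw [coord_add, coord_smul, coord_smul, op_add, op_smul, op_smul]
    refine (norm_add_le _ _).trans ?_
    rw [norm_smul, norm_smul, Complex.norm_of_nonneg ha, Complex.norm_of_nonneg hb]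
    calc a * ‖(x.coord i).op‖ + b * ‖(y.coord i).op‖ ≤ a * n + b * n := by
          gcongr
          exacts [hx i, hy i]
      _ = n := by rw [← add_mul, hab, one_mul]
  · rw [Completion.coe_add, Completion.coe_smul, Completion.coe_smul]

theorem ball_nonempty (n : ℕ) : (ball U M n).Nonempty :=
  ⟨((0 : Bdd U M) : L2 U M), 0, fun i => by rw [coord_zero, op_zero]; simp, rfl⟩

theorem norm_le_of_mem_ball {n : ℕ} {v : L2 U M} (hv : v ∈ ball U M n) : ‖v‖ ≤ n := by
  obtain ⟨x, hx, rfl⟩ := hv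
  rw [Completion.norm_coe]
  exact norm_le x n hx

/-- Families bounded in the sense of metric structures. -/
def ofFamily (U : Ultrafilter I) {s : tracialLanguage.Srt}
    (x : BoundedFamily (fun i => (M i).toStructure) s) : Bdd U M := ⟨x.1, x.2⟩

theorem dist_coe_ofFamily {s : tracialLanguage.Srt}
    (x y : BoundedFamily (fun i => (M i).toStructure) s) :
    dist (ofFamily U x : L2 U M) (ofFamily U y : L2 U M) =
      dist (UltraCarrier.mk U x) (UltraCarrier.mk U y) := by
  rw [Completion.dist_eq, dist_eq_norm]
  refine tendsto_nhds_unique (tendsto_norm _) ?_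
  refine (UltraCarrier.tendsto_dist U x y).congr fun i => ?_
  exact dist_eq_norm (E := (M i).Elem) _ _

/-- The ball is the isometric image of a domain of the metric ultraproduct, whose completeness is
already known. -/
theorem isComplete_ball (n : ℕ) : IsComplete (ball U M n) := by
  have s : tracialLanguage.Srt := ()
  let ι : UltraCarrier U (fun i => (M i).toStructure) s → L2 U M :=
    fun q => (ofFamily U q.rep : L2 U M)
  have hι : Isometry ι := Isometry.of_dist_eq fun q q' => by
    rw [dist_coe_ofFamily, UltraCarrier.mk_rep, UltraCarrier.mk_rep]
  have hmk : ∀ x, ι (UltraCarrier.mk U x) = (ofFamily U x : L2 U M) := fun x =>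
    dist_le_zero.1 (by rw [dist_coe_ofFamily, UltraCarrier.mk_rep, dist_self])
  have h := (isComplete_image_iff hι.isUniformInducing).2
    (UltraCarrier.isComplete_dom U (fun i => (M i).toStructure) (s := s) n)
  refine (congrArg IsComplete (Set.ext fun v => ?_)).mp h
  refine Iff.symm ⟨?_, ?_⟩
  · rintro ⟨x, hx, rfl⟩
    exact ⟨_, ⟨⟨x.1, x.2⟩, hx, rfl⟩, hmk _⟩
  · rintro ⟨_, ⟨x, hx, rfl⟩, rfl⟩
    exact ⟨ofFamily U x, hx, (hmk x).symm⟩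

/-- Linear functionals do not separate `T Ω` from the ball. Write `y = w k²` approximately polar in
each coordinate. Since `T` commutes with right multiplication by `k`, one has `⟪y, T Ω⟫ = ⟪w k, T
k⟫`, with real part at most `n ‖k‖² ≤ n (Re tr(y* w) + ε)`; the vector of the ball is `n w`. -/
theorem exists_mem_ball_re_inner_le {T : L2 U M →L[ℂ] L2 U M} (hT : T ∈ algebra U M) {n : ℕ}
    (hn : ‖T‖ ≤ n) (y : Bdd U M) {ε : ℝ} (hε : 0 < ε) :
    ∃ v ∈ ball U M n, (inner ℂ (y : L2 U M) (T (vacuum U M))).re ≤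
      (inner ℂ (y : L2 U M) v).re + n * ε := by
  obtain ⟨m, hm⟩ := y.exists_bound
  choose w k hw hk hkn hwk htr using fun i => (M i).exists_approx_polar (y.coord i) hε
  let w' : Bdd U M := of U w 1 fun i => by simpa [opBall] using hw i
  -- `‖k‖² ≤ m + ε` in every coordinate gives the uniform bound `‖k‖ ≤ m + ε + 1`, so the roots form
  -- a bounded family.
  let k' : Bdd U M := of U k ⌈(m : ℝ) + ε + 1⌉₊ fun i => by
    refine le_trans ?_ (Nat.le_ceil ((m : ℝ) + ε + 1))
    nlinarith [hkn i, hm i, norm_nonneg (k i).op]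
  have hk' : star k' = k' := ext hk
  have hy : y = w' * k' * k' := ext hwk
  have hkk : ‖k'‖ ^ 2 ≤ (star y * w').trace.re + ε := by
    rw [norm_sq, hk']
    exact le_of_tendsto_of_tendsto' ((Complex.continuous_re.tendsto _).comp (k' * k').tendsto_trace)
      (((Complex.continuous_re.tendsto _).comp (star y * w').tendsto_trace).add_const ε) htr
  have hwk' : ‖w' * k'‖ ≤ ‖k'‖ := by
    simpa using norm_mul_le_left w' k' 1 hw
  refine ⟨(((n : ℂ) • w' : Bdd U M) : L2 U M), ⟨_, fun i => ?_, rfl⟩, ?_⟩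
  · rw [coord_smul, op_smul, norm_smul, Complex.norm_natCast]
    exact mul_le_of_le_one_right (Nat.cast_nonneg _) (hw i)
  · have h1 : (inner ℂ (y : L2 U M) (T (vacuum U M))) =
        inner ℂ ((w' * k' : Bdd U M) : L2 U M) (T (k' : L2 U M)) := by
      have e1 : (y : L2 U M) = star k'.right ((w' * k' : Bdd U M) : L2 U M) := by
        rw [star_right, hk', right_coe, ← hy]
      rw [e1, ContinuousLinearMap.star_eq_adjoint, ContinuousLinearMap.adjoint_inner_left,
        ← mul_apply_eq_comp, mem_algebra_iff.1 hT, mul_apply_eq_comp,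
        right_vacuum]
    have h2 : (inner ℂ (y : L2 U M) (((n : ℂ) • w' : Bdd U M) : L2 U M)).re =
        n * (star y * w').trace.re := by
      rw [Completion.inner_coe, inner_smul_right, inner_def]
      simp
    rw [h1, h2]
    calc (inner ℂ ((w' * k' : Bdd U M) : L2 U M) (T (k' : L2 U M))).re
        ≤ ‖((w' * k' : Bdd U M) : L2 U M)‖ * ‖T (k' : L2 U M)‖ :=
          (Complex.re_le_norm _).trans (norm_inner_le_norm _ _)
      _ ≤ ‖k'‖ * (n * ‖k'‖) := by
          rw [Completion.norm_coe]
          gcongr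
          refine (T.le_opNorm _).trans ?_
          rw [Completion.norm_coe]
          gcongr
      _ = n * ‖k'‖ ^ 2 := by ring
      _ ≤ n * ((star y * w').trace.re + ε) := by gcongr
      _ = _ := by ring

/-- With `p` the point of the ball nearest to `ξ = T Ω` and `η = ξ - p`, the functional `Re ⟪η, ·⟫`
is maximal on the ball at `p`, and `Re ⟪η, ξ⟫` exceeds this maximum by `‖η‖²`. The preceding
estimate, for a bounded family close to `η`, forces `η = 0`. -/
theorem apply_vacuum_mem_ball {T : L2 U M →L[ℂ] L2 U M} (hT : T ∈ algebra U M) {n : ℕ}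
    (hn : ‖T‖ ≤ n) : T (vacuum U M) ∈ ball U M n := by
  set ξ := T (vacuum U M) with hξ
  have hξn : ‖ξ‖ ≤ n := by
    refine (T.le_opNorm _).trans ?_
    rw [vacuum, Completion.norm_coe, norm_one, mul_one]
    exact hn
  obtain ⟨p, hp, hp'⟩ := exists_re_inner_sub_le_zero (ball_nonempty n)
    (isComplete_ball n) (convex_ball n) ξ
  set η := ξ - p with hη
  have hle : ∀ v ∈ ball U M n, (inner ℂ η v).re ≤ (inner ℂ η p).re := fun v hv => by
    have h := hp' v hv
    rw [inner_sub_right, Complex.sub_re] at h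
    linarith
  have hnn : (0 : ℝ) ≤ n := Nat.cast_nonneg n
  -- One `n ε` comes from the estimate for `y`, the other two from replacing `η` by `y` at `ξ` and
  -- at `v`.
  have hbound : ∀ ε > 0, ‖η‖ ^ 2 ≤ 0 + 3 * n * ε := by
    intro ε hε
    obtain ⟨y, hy⟩ : ∃ y : Bdd U M, dist η (y : L2 U M) < ε :=
      Completion.denseRange_coe.exists_dist_lt η hε
    have hclose : ∀ v : L2 U M, ‖v‖ ≤ n →
        |(inner ℂ η v).re - (inner ℂ (y : L2 U M) v).re| ≤ ε * n := fun v hv => by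
      rw [← Complex.sub_re, ← inner_sub_left]
      refine (Complex.abs_re_le_norm _).trans ((norm_inner_le_norm _ _).trans ?_)
      rw [← dist_eq_norm]
      gcongr
    obtain ⟨v, hv, hyv⟩ := exists_mem_ball_re_inner_le hT hn y hε
    have h1 := abs_le.1 (hclose ξ hξn)
    have h2 := abs_le.1 (hclose v (norm_le_of_mem_ball hv))
    have h3 := hle v hv
    have h4 : ‖η‖ ^ 2 = (inner ℂ η ξ).re - (inner ℂ η p).re := by
      rw [← Complex.sub_re, ← inner_sub_right, ← hη, @norm_sq_eq_re_inner ℂ]; rfl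
    rw [h4]
    linarith [h1.2, h2.1]
  have hz : ‖η‖ ^ 2 ≤ 0 := by
    refine le_of_forall_pos_le_add fun δ hδ => ?_
    refine (hbound (δ / (3 * n + 1)) (by positivity)).trans ?_
    rw [zero_add, zero_add, ← mul_div_assoc, div_le_iff₀ (by positivity)]
    nlinarith
  have hη0 : η = 0 := norm_eq_zero.1 (pow_eq_zero_iff two_ne_zero |>.1
    (le_antisymm hz (by positivity)))
  rw [sub_eq_zero.1 hη0]
  exact hp

/-- Right multiplications carry the vacuum to a dense set of vectors, so it is separating for the
operators that commute with them. -/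
theorem eq_left_of_apply_vacuum {T : L2 U M →L[ℂ] L2 U M} (hT : T ∈ algebra U M) {x : Bdd U M}
    (h : T (vacuum U M) = x) : T = x.left := clm_ext fun y => by
  rw [left_coe, ← right_vacuum y, ← mul_apply_eq_comp, ← mem_algebra_iff.1 hT,
    mul_apply_eq_comp, h, right_coe]

/-- Operators commuting with right multiplications are left multiplications by families with the
same bound on the operator norm. -/
theorem exists_eq_left {T : L2 U M →L[ℂ] L2 U M} (hT : T ∈ algebra U M) {n : ℕ}
    (hn : ‖T‖ ≤ n) : ∃ x : Bdd U M, (∀ i, ‖(x.coord i).op‖ ≤ n) ∧ T = x.left := by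
  obtain ⟨x, hx, h⟩ := apply_vacuum_mem_ball hT hn
  exact ⟨x, hx, eq_left_of_apply_vacuum hT h.symm⟩

theorem inner_vacuum_left (x : Bdd U M) :
    inner ℂ (vacuum U M) (x.left (vacuum U M)) = x.trace := by
  rw [left_vacuum, vacuum, Completion.inner_coe, inner_def, star_one, one_mul]

end TracialVNA.Bdd

open TracialVNA.Bdd in
/-- The tracial ultraproduct as a tracial von Neumann algebra. -/
noncomputable def TracialVNA.ultraproduct (U : Ultrafilter I) (M : I → TracialVNA.{w}) :
    TracialVNA.{w} where
  H := L2 U M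
  alg := algebra U M
  tr :=
    { toFun := fun T => inner ℂ (vacuum U M) (T.1 (vacuum U M))
      map_add' := fun S T => inner_add_right _ _ _
      map_smul' := fun c T => inner_smul_right _ _ _ }
  tr_one := by
    have h := inner_vacuum_left (1 : Bdd U M)
    rwa [left_one, trace_one] at h
  tr_nonneg T := by
    refine ⟨‖T.1 (vacuum U M)‖ ^ 2, by positivity, ?_⟩
    show inner ℂ (vacuum U M) (star T.1 (T.1 (vacuum U M))) = _
    rw [ContinuousLinearMap.star_eq_adjoint, ContinuousLinearMap.adjoint_inner_right,
      inner_self_eq_norm_sq_to_K]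
    simp
  tr_faithful T h := by
    have h' : inner ℂ (vacuum U M) (star T.1 (T.1 (vacuum U M))) = (0 : ℂ) := h
    rw [ContinuousLinearMap.star_eq_adjoint, ContinuousLinearMap.adjoint_inner_right,
      inner_self_eq_zero] at h'
    refine Subtype.ext ((eq_left_of_apply_vacuum T.2 (x := 0) ?_).trans left_zero)
    rw [h', Completion.coe_zero]
  tr_comm S T := by
    -- Once the operators are left multiplications, the trace property passes to the limit from the
    -- factors.
    obtain ⟨x, -, hx⟩ := exists_eq_left S.2 (Nat.le_ceil ‖S.1‖)
    obtain ⟨y, -, hy⟩ := exists_eq_left T.2 (Nat.le_ceil ‖T.1‖)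
    show inner ℂ (vacuum U M) ((S.1 * T.1) (vacuum U M)) =
      inner ℂ (vacuum U M) ((T.1 * S.1) (vacuum U M))
    rw [hx, hy, ← left_mul, ← left_mul, inner_vacuum_left, inner_vacuum_left, trace_mul_comm]
  tr_normal := by
    -- The trace is the vector state of the vacuum, so sequences with one nonzero term witness
    -- normality.
    refine ⟨Pi.single 0 (vacuum U M), Pi.single 0 (vacuum U M), ?_, ?_, fun T => ?_⟩
    · refine summable_of_ne_finset_zero (s := {0}) fun n hn => ?_
      rw [Pi.single_eq_of_ne (by simpa using hn)]; simp
    · refine summable_of_ne_finset_zero (s := {0}) fun n hn => ?_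
      rw [Pi.single_eq_of_ne (by simpa using hn)]; simp
    · convert hasSum_single 0 fun n hn => ?_ using 1
      · simp
      · rw [Pi.single_eq_of_ne hn, inner_zero_left]

/-- Left multiplication by a bounded family. -/
noncomputable def TracialVNA.Bdd.toElem (x : TracialVNA.Bdd U M) :
    (TracialVNA.ultraproduct U M).Elem := ⟨x.left, x.left_mem_algebra⟩

open TracialVNA TracialVNA.Bdd in
theorem TracialVNA.Bdd.trace_toElem (x : TracialVNA.Bdd U M) :
    (TracialVNA.ultraproduct U M).trace x.toElem = x.trace := inner_vacuum_left x

open TracialVNA TracialVNA.Bdd in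
theorem TracialVNA.Bdd.norm_toElem (x : TracialVNA.Bdd U M) : ‖x.toElem‖ = ‖x‖ := by
  have h : star x.toElem * x.toElem = (star x * x).toElem := Subtype.ext (by
    show star x.left * x.left = (star x * x).left
    rw [star_left, left_mul])
  rw [← Real.sqrt_sq (norm_nonneg x), TracialVNA.norm_def, h, trace_toElem, Bdd.norm_sq]

open TracialVNA TracialVNA.Bdd in
/-- The metric ultraproduct of tracial von Neumann algebras is isomorphic to the tracial
ultraproduct. -/
theorem TracialVNA.exists_ultraproduct_embeddings (U : Ultrafilter I) (M : I → TracialVNA.{w}) :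
    Nonempty ((MetricStructure.ultraproduct U fun i => (M i).toStructure).Embedding
      (TracialVNA.ultraproduct U M).toStructure) ∧
    Nonempty ((TracialVNA.ultraproduct U M).toStructure.Embedding
      (MetricStructure.ultraproduct U fun i => (M i).toStructure)) := by
  have hsub : ∀ x y : Bdd U M, x.toElem - y.toElem = (x - y).toElem := fun x y =>
    Subtype.ext (left_sub x y).symm
  let F : ∀ s, BoundedFamily (fun i => (M i).toStructure) s →
      (TracialVNA.ultraproduct U M).toStructure.carrier s := fun _ x => (ofFamily U x).toElem
  have hdist : ∀ s x y, dist (F s x) (F s y) =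
      dist (UltraCarrier.mk U x) (UltraCarrier.mk U y) := by
    intro s x y
    rw [← dist_coe_ofFamily, Completion.dist_eq, dist_eq_norm, ← norm_toElem, ← hsub]
    exact dist_eq_norm (E := (TracialVNA.ultraproduct U M).Elem) _ _
  have hfunc : ∀ (f : tracialLanguage.Func) x, F _ (BoundedFamily.func f x) =
      (TracialVNA.ultraproduct U M).toStructure.func f fun j => F _ (x j) := fun f x => by
    cases f with
    | zero => exact Subtype.ext left_zero
    | one => exact Subtype.ext left_one
    | add => exact Subtype.ext (left_add _ _)
    | mul => exact Subtype.ext (left_mul _ _)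
    | star => exact Subtype.ext (star_left _).symm
    | smul c => exact Subtype.ext (left_smul c _)
  have hrel : ∀ (R : tracialLanguage.Rel)
      (x : ∀ j, BoundedFamily (fun i => (M i).toStructure) (tracialLanguage.relIn R j)),
      (TracialVNA.ultraproduct U M).toStructure.rel R (fun j => F _ (x j)) =
        ultraLim U fun i => (M i).toStructure.rel R fun j => (x j).1 i := fun R x => by
    refine tendsto_nhds_unique ?_ (BoundedFamily.tendsto_rel U R x)
    have h := (ofFamily U (x (0 : Fin 1))).tendsto_trace
    rw [← trace_toElem] at h
    cases R with
    | trRe => exact (Complex.continuous_re.tendsto _).comp h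
    | trIm => exact (Complex.continuous_im.tendsto _).comp h
  let e : (MetricStructure.ultraproduct U fun i => (M i).toStructure).Embedding
      (TracialVNA.ultraproduct U M).toStructure :=
    .ofFamilies U F hdist (fun s n x hx => norm_left_le _ _ (Nat.cast_nonneg n) hx) hfunc hrel
  have he : ∀ s x, e.toFun s (UltraCarrier.mk U x) = F s x :=
    fun s x => MetricStructure.Embedding.ofFamilies_mk U F hdist _ hfunc hrel x
  -- Every operator of norm at most `n` lifts to a family bounded by the same `n`; without this
  -- exactness the inverse map would not preserve the domains.
  have key : ∀ (T : (TracialVNA.ultraproduct U M).Elem) (n : ℕ), ‖T.op‖ ≤ n →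
      ∃ q ∈ (MetricStructure.ultraproduct U fun i => (M i).toStructure).dom (s := ()) n,
        e.toFun () q = T := by
    intro T n hn
    obtain ⟨x, hx, h⟩ := exists_eq_left T.2 hn
    exact ⟨UltraCarrier.mk U ⟨x.1, x.2⟩, MetricStructure.mk_mem_dom U hx,
      (he () _).trans (Subtype.ext h.symm)⟩
  refine ⟨⟨e⟩, e.exists_inverse (fun s T => ?_) fun s n q hq => ?_⟩
  · obtain ⟨q, -, hq⟩ := key T _ (Nat.le_ceil _)
    exact ⟨q, hq⟩
  · obtain ⟨q', hq', h⟩ := key _ n hq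
    rwa [← e.injective s h]

end TracialUltraproduct

/-! ### Strong amalgamation of ultrapower-embeddable algebras. -/

theorem MetricStructure.range_comp_inter_range_comp {L : MetricLanguage.{u}}
    {B C D E : MetricStructure.{u, w} L} (h : D.Embedding E) (f : B.Embedding D)
    (g : C.Embedding D) (s : L.Srt) :
    Set.range ((h.comp f).toFun s) ∩ Set.range ((h.comp g).toFun s) =
      h.toFun s '' (Set.range (f.toFun s) ∩ Set.range (g.toFun s)) := by
  rw [Set.image_inter (h.injective s), ← Set.range_comp, ← Set.range_comp]
  rfl

/-- Members of this class are by definition structures of actual algebras, so the ultrapower of `C`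
is not itself offered as the amalgam. It is embedded in the tracial ultrapower of `R` along the
iterated ultrafilter. Enlarging an amalgam by an injective map preserves the intersection condition.
-/
theorem MetricStructure.IsECMember.isStrongAmalgamationBase_ultrapowerEmbeddableClass
    (R : TracialVNA.{w}) {A : MetricStructure.{0, w} tracialLanguage}
    (hA : IsECMember R.ultrapowerEmbeddableClass A) :
    IsStrongAmalgamationBase R.ultrapowerEmbeddableClass A := by
  refine ⟨hA.1, fun B hB C hC i j => ?_⟩
  obtain ⟨I, U, f, g, hcomm, hinter⟩ := exists_strong_amalgam.{0, w} i (hA.2 B hB i) j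
  obtain ⟨N, ⟨J, V, hV, ⟨κ⟩⟩, rfl⟩ := hC
  obtain ⟨d⟩ := nonempty_embedding_iterated U V (N := fun _ _ => R.toStructure)
  obtain ⟨⟨e⟩, he⟩ := TracialVNA.exists_ultraproduct_embeddings (U.iterated V) fun _ => R
  -- The composite `C^U → (R^V)^U → R^W`, with `W = U.iterated V`, followed by the identification of
  -- the last ultrapower with a von Neumann algebra.
  let h := (e.comp d).comp (.ultraMap U fun _ => κ)
  refine ⟨_, ⟨_, ⟨I × J, U.iterated V, U.iterated_ne_pure V hV, he⟩, rfl⟩, h.comp f, h.comp g,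
    fun s a => congrArg (h.toFun s) (hcomm s a), fun s => ?_⟩
  rw [range_comp_inter_range_comp, hinter, ← Set.range_comp]
  rfl

theorem mainTheorem8 :
    (∀ (L : MetricLanguage.{u}) (T : Set L.Sentence) (A : MetricStructure.{u, max u w} L),
      MetricStructure.IsECMember (MetricStructure.Mod T) A →
        MetricStructure.IsStrongAmalgamationBase (MetricStructure.Mod T) A) ∧
    (∀ R : TracialVNA.{w}, R.IsHyperfiniteII1Factor →
      ∀ A : MetricStructure.{0, w} tracialLanguage,
        MetricStructure.IsECMember R.ultrapowerEmbeddableClass A →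
          MetricStructure.IsStrongAmalgamationBase R.ultrapowerEmbeddableClass A) := by
  exact ⟨fun _ _ _ hA => hA.isStrongAmalgamationBase_Mod,
    fun R _ _ hA => hA.isStrongAmalgamationBase_ultrapowerEmbeddableClass R⟩
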